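/- Let $\mathcal X$ be an order-enriched category (hom-sets are posets, composition is monotone in both variables) which is locally ranked with respect to a proper factorization system $(\mathcal E,\mathcal M)$ (members of $\mathcal E$ are epimorphisms; members of $\mathcal M$ are order-monomorphisms, i.e. $mf\le mg$ implies $f\le g$): $\mathcal X$ has weighted colimits, is $\mathcal E$-cowellpowered, and every object $A$ has a rank, i.e. there is an infinite regular cardinal $\lambda$ such that whenever an object $Y$ is the union of a $\lambda$-chain of $\mathcal M$-subobjects, every morphism $A\to Y$ factorizes through a member of the chain. Let $\mathcal H$ be a (small) set of morphisms of $\mathcal X$. Let $\mathsf{LInj}(\mathcal H)$ be the (not necessarily full) subcategory of all objects and morphisms that are left Kan-injective with respect to every $h:A\to A'$ in $\mathcal H$: an object $X$ is so if for every $f:A\to X$ the left Kan extension $f/h:A'\to X$ (the least $g$ with $f\le gh$) exists and satisfies $(f/h)h=f$; a morphism $p:X\to X'$ is so if $X$ and $X'$ are and $p\cdot(f/h)=(pf)/h$ for all $f:A\to X$. **Theorem.** $\mathsf{LInj}(\mathcal H)$ is a KZ-monadic subcategory of $\mathcal X$, i.e. it is the Eilenberg–Moore category, over $\mathcal X$,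 of a Kock–Zöberlein monad on $\mathcal X$ (a monad $(T,\eta,\mu)$ with $T$ locally monotone and $T\eta\le\eta T$). More precisely, the inclusion $\mathsf{LInj}(\mathcal H)\to\mathcal X$ has a left adjoint, the induced monad is a Kock–Zöberlein monad, and the comparison functor from $\mathsf{LInj}(\mathcal H)$ to its Eilenberg–Moore category is an isomorphism of categories. Moreover, the reflections are obtained as follows. A *Kan-injective reflection chain* of an object $X_0$ is a chain $(X_i)_{i\in\mathrm{Ord}}$ starting at $X_0$, with connecting maps $x_{ij}:X_i\to X_j$ for $i\le j$, such that: * for limit ordinals $i$, $X_i$ is the conical colimit of $(X_j)_{j<i}$; * for even $i$ (i.e. $i=\ell+2n$ with $n<\omega$ and $\ell$ zero or a limit ordinal), $X_{i+1}$ is the conical colimit of the diagram of all spans $X_i\xleftarrow{f}A\xrightarrow{h}A'$ with $h\in\mathcal H$, with colimit morphisms $x_{i,i+1}$ and $f/\!/h:A'\to X_{i+1}$; * for even $i$, $x_{i+1,i+2}$ is the universal morphism such that $x_{i+1,i+2}\,x_{j+1,i+1}\,(f/\!/h)\le x_{i+1,i+2}\,g$ whenever $h:A\to A'$ is in $\mathcal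 H$, $j\le i$ is even, $f:A\to X_j$, $g:A'\to X_{i+1}$ and $x_{j,i+1}f\le gh$. A *Reiterman function* for the chain is a function $\phi:\mathrm{Ord}\to\mathrm{Ord}$ with $\phi(0)=0$, with $\phi(i)=\bigvee_{j<i}\phi(j)$ for limit ordinals $i$, and such that $\phi(i+1)>\phi(i)$ is an even ordinal for which the $\mathcal E$-parts of the $(\mathcal E,\mathcal M)$-factorizations of all $x_{\phi(i),j}$ with $j\ge\phi(i+1)$ represent the same quotient of $X_{\phi(i)}$. Every object $X_0$ has a Kan-injective reflection chain, and for every such chain: 1. there are an infinite regular cardinal $\lambda$ and a Reiterman function $\phi$ such that $x_{0,\phi(\lambda)}:X_0\to X_{\phi(\lambda)}$ is a reflection of $X_0$ in $\mathsf{LInj}(\mathcal H)$; 2. if $\lambda$ is an infinite regular cardinal such that the domains and codomains of all members of $\mathcal H$ have rank $\lambda$, then Reiterman functions exist, and for every Reiterman function $\phi$ the morphism $x_{0,\phi(\lambda)}:X_0\to X_{\phi(\lambda)}$ is a reflection of $X_0$ in $\mathsf{LInj}(\mathcal H)$. -/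

import Mathlib

open CategoryTheory Opposite

universe w' w v' v u' u

namespace KanInj

/-! ### Order-enriched categories and locally monotone functors -/

/-- An order-enriched category: every hom-set is partially ordered and composition is monotone in
both variables. -/
class OrderEnriched (C : Type u) [Category.{v} C] where
  homOrder : ∀ X Y : C, PartialOrder (X ⟶ Y)
  comp_mono : ∀ {X Y Z : C} {f f' : X ⟶ Y} {g g' : Y ⟶ Z},
    (homOrder X Y).le f f' → (homOrder Y Z).le g g' → (homOrder X Z).le (f ≫ g) (f' ≫ g')

instance {C : Type u} [Category.{v} C] [OrderEnriched C] (X Y : C) : PartialOrder (X ⟶ Y) :=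
  OrderEnriched.homOrder X Y

/-- The opposite category, with the same order on hom-sets. -/
instance {C : Type u} [Category.{v} C] [OrderEnriched C] : OrderEnriched Cᵒᵖ where
  homOrder X Y := PartialOrder.lift (fun f : X ⟶ Y => f.unop) (fun _ _ h => Quiver.Hom.unop_inj h)
  comp_mono h₁ h₂ := OrderEnriched.comp_mono (C := C) h₂ h₁

/-- The category of posets and monotone maps, with hom-sets ordered pointwise. -/
instance : OrderEnriched PartOrd.{w} where
  homOrder X Y := PartialOrder.lift (fun f : X ⟶ Y => f.hom) (fun _ _ h => PartOrd.hom_ext h)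
  comp_mono {_ _ _ _ f' g _} h₁ h₂ := fun x =>
    le_trans (g.hom.monotone (h₁ x)) (h₂ (f'.hom x))

/-- A locally monotone functor: it is monotone on hom-sets. -/
def LocallyMonotone {C : Type u} [Category.{v} C] [OrderEnriched C]
    {D : Type u'} [Category.{v'} D] [OrderEnriched D] (F : C ⥤ D) : Prop :=
  ∀ ⦃X Y : C⦄ ⦃f g : X ⟶ Y⦄, f ≤ g → F.map f ≤ F.map g

section Basic

variable {C : Type u} [Category.{v} C] [OrderEnriched C]

/-- `i` is an order-monomorphism. -/
def IsOrderMono {X Y : C} (i : X ⟶ Y) : Prop :=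
  ∀ ⦃Z : C⦄ (f g : Z ⟶ X), f ≫ i ≤ g ≫ i → f ≤ g

/-- `e` is an order-epimorphism. -/
def IsOrderEpi {X Y : C} (e : X ⟶ Y) : Prop :=
  ∀ ⦃Z : C⦄ (f g : Y ⟶ Z), e ≫ f ≤ e ≫ g → f ≤ g

/-! ### Weighted colimits -/

/-- For `F : D ⥤ C`, a weight `W : Dᵒᵖ ⥤ PartOrd` and an object `Z` of `C`: a natural
transformation from `W` to `C(F -, Z)` in the category of posets. -/
structure WeightedCocone {D : Type w} [Category.{w'} D] (F : D ⥤ C) (W : Dᵒᵖ ⥤ PartOrd.{v'})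
    (Z : C) where
  app : ∀ d : D, W.obj (op d) → (F.obj d ⟶ Z)
  monotone : ∀ d : D, Monotone (app d)
  naturality : ∀ ⦃d d' : D⦄ (g : d ⟶ d') (x : W.obj (op d')),
    app d ((W.map g.op).hom x) = F.map g ≫ app d' x

/-- The weighted cocone `c` with vertex `L` exhibits `L` as the colimit of `F` weighted by `W`:
for every `Z`, composing with `c` is an isomorphism of posets from `C(L, Z)` onto the natural
transformations from `W` to `C(F -, Z)`, ordered objectwise. -/
structure IsWeightedColimit {D : Type w} [Category.{w'} D] {F : D ⥤ C} {W : Dᵒᵖ ⥤ PartOrd.{v'}}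
    {L : C} (c : WeightedCocone F W L) : Prop where
  existsUnique : ∀ ⦃Z : C⦄ (t : WeightedCocone F W Z),
    ∃! f : L ⟶ Z, ∀ (d : D) (x : W.obj (op d)), c.app d x ≫ f = t.app d x
  le_of_le : ∀ ⦃Z : C⦄ (f g : L ⟶ Z),
    (∀ (d : D) (x : W.obj (op d)), c.app d x ≫ f ≤ c.app d x ≫ g) → f ≤ g

variable (C) in
/-- `C` has weighted colimits: for all small order-enriched `D`, all locally monotone
`F : D ⥤ C` and all locally monotone weights `W : Dᵒᵖ ⥤ PartOrd`. -/
def HasWeightedColimits : Prop :=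
  ∀ (D : Type v) [Category.{v} D] [OrderEnriched D] (F : D ⥤ C) (W : Dᵒᵖ ⥤ PartOrd.{v}),
    LocallyMonotone F → LocallyMonotone W →
      ∃ (L : C) (c : WeightedCocone F W L), IsWeightedColimit c

/-! ### Locally ranked categories -/

/-- `(E, M)` is a proper factorization system of an order-enriched category: both classes are
closed under composition with isomorphisms, every morphism factorizes as a member of `E` followed
by a member of `M`, the unique diagonal fill-in property holds, all members of `E` are
epimorphisms and all members of `M` are order-monomorphisms. -/
structure IsProperFactorizationSystem (E M : MorphismProperty C) : Prop where
  respectsIso_left : E.RespectsIso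
  respectsIso_right : M.RespectsIso
  factorization : ∀ ⦃X Y : C⦄ (f : X ⟶ Y),
    ∃ (Z : C) (e : X ⟶ Z) (m : Z ⟶ Y), E e ∧ M m ∧ e ≫ m = f
  diagonal : ∀ ⦃X Y Z T : C⦄ (e : X ⟶ Y) (m : Z ⟶ T) (f : X ⟶ Z) (g : Y ⟶ T),
    E e → M m → f ≫ m = e ≫ g → ∃! d : Y ⟶ Z, e ≫ d = f ∧ d ≫ m = g
  epi : ∀ ⦃X Y : C⦄ (e : X ⟶ Y), E e → Epi e
  orderMono : ∀ ⦃X Y : C⦄ (m : X ⟶ Y), M m → IsOrderMono m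

/-- `C` is `E`-cowellpowered: every object has, up to isomorphism, only a small set of
quotients `X ⟶ Y` in `E`. -/
def IsCowellpowered (E : MorphismProperty C) : Prop :=
  ∀ X : C, ∃ (ι : Type v) (Y : ι → C) (q : ∀ a, X ⟶ Y a),
    ∀ ⦃Z : C⦄ (e : X ⟶ Z), E e → ∃ (a : ι) (s : Y a ≅ Z), q a ≫ s.hom = e

/-- A family of subobjects `m a : N a ⟶ X` has union `X` (it has the join `X` in the poset of
`M`-subobjects of `X`): every `M`-subobject of `X` that contains all of them is all of `X`. -/
def IsUnion (M : MorphismProperty C) {ι : Type w} {X : C} {N : ι → C} (m : ∀ a, N a ⟶ X) : Prop :=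
  ∀ ⦃Q : C⦄ (n : Q ⟶ X), M n → (∀ a, ∃ t : N a ⟶ Q, t ≫ n = m a) → IsIso n

/-- The object `A` has rank `κ`, an infinite regular cardinal: whenever `X` is the union of a
`κ`-chain of `M`-subobjects, each morphism `A ⟶ X` factorizes through a member of the chain. -/
def HasRank (M : MorphismProperty C) (κ : Cardinal.{v}) (A : C) : Prop :=
  κ.IsRegular ∧ ∀ ⦃X : C⦄ (N : Set.Iio κ.ord → C) (m : ∀ a, N a ⟶ X),
    (∀ a, M (m a)) →
    (∀ a b, a ≤ b → ∃ t : N a ⟶ N b, t ≫ m b = m a) →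
    IsUnion M m →
    ∀ p : A ⟶ X, ∃ (a : Set.Iio κ.ord) (q : A ⟶ N a), q ≫ m a = p

/-- The order-enriched category `C` is locally ranked with respect to `(E, M)`. -/
structure IsLocallyRanked (E M : MorphismProperty C) : Prop where
  proper : IsProperFactorizationSystem E M
  hasWeightedColimits : HasWeightedColimits C
  cowellpowered : IsCowellpowered E
  rank : ∀ A : C, ∃ κ : Cardinal.{v}, HasRank M κ A

/-! ### Left Kan-injectivity -/

/-- `g` is the left Kan extension of `f` along `h`. -/
def IsLan {A A' X : C} (h : A ⟶ A') (f : A ⟶ X) (g : A' ⟶ X) : Prop :=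
  f ≤ h ≫ g ∧ ∀ g' : A' ⟶ X, f ≤ h ≫ g' → g ≤ g'

/-- The object `X` is left Kan-injective with respect to `h`. -/
def KanInjectiveObj {A A' : C} (h : A ⟶ A') (X : C) : Prop :=
  ∀ f : A ⟶ X, ∃ g : A' ⟶ X, IsLan h f g ∧ h ≫ g = f

/-- The morphism `p` is left Kan-injective with respect to `h`: domain and codomain are, and `p`
preserves left Kan extensions along `h`. -/
def KanInjectiveHom {A A' : C} (h : A ⟶ A') {X X' : C} (p : X ⟶ X') : Prop :=
  KanInjectiveObj h X ∧ KanInjectiveObj h X' ∧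
    ∀ (f : A ⟶ X) (g : A' ⟶ X), IsLan h f g → IsLan h (f ≫ p) (g ≫ p)

end Basic

/-! ### Subcategories (not necessarily full) -/

/-- A subcategory of `C`: a class of objects and a class of morphisms between them, containing
the identities of these objects and closed under composition. -/
structure Subcat (C : Type u) [Category.{v} C] where
  obj : C → Prop
  hom : ∀ ⦃X Y : C⦄, (X ⟶ Y) → Prop
  dom : ∀ ⦃X Y : C⦄ (f : X ⟶ Y), hom f → obj X
  cod : ∀ ⦃X Y : C⦄ (f : X ⟶ Y), hom f → obj Y
  id : ∀ ⦃X : C⦄, obj X → hom (𝟙 X)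
  comp : ∀ ⦃X Y Z : C⦄ (f : X ⟶ Y) (g : Y ⟶ Z), hom f → hom g → hom (f ≫ g)

namespace Subcat

variable {C : Type u} [Category.{v} C]

/-- The objects of a subcategory. -/
@[ext]
structure Obj (S : Subcat C) where
  val : C
  property : S.obj val

/-- The morphisms of a subcategory. -/
@[ext]
structure Hom {S : Subcat C} (X Y : S.Obj) where
  val : X.val ⟶ Y.val
  property : S.hom val

/-- A subcategory, regarded as a category. -/
instance (S : Subcat C) : Category.{v} S.Obj where
  Hom X Y := Hom X Y
  id X := ⟨𝟙 X.val, S.id X.property⟩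
  comp f g := ⟨f.val ≫ g.val, S.comp _ _ f.property g.property⟩
  id_comp _ := Hom.ext (Category.id_comp _)
  comp_id _ := Hom.ext (Category.comp_id _)
  assoc _ _ _ := Hom.ext (Category.assoc _ _ _)

/-- The inclusion functor of a subcategory. -/
def incl (S : Subcat C) : S.Obj ⥤ C where
  obj X := X.val
  map f := f.val

/-- `r : X ⟶ R` is a reflection of `X` in the subcategory `S`. -/
def IsReflection (S : Subcat C) {X R : C} (r : X ⟶ R) : Prop :=
  S.obj R ∧ ∀ ⦃P : C⦄, S.obj P → ∀ p : X ⟶ P, ∃! q : R ⟶ P, S.hom q ∧ r ≫ q = p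

end Subcat

section Kan

variable {C : Type u} [Category.{v} C] [OrderEnriched C]

/-- The subcategory of all objects and all morphisms of `C` that are left Kan-injective with
respect to all members of `H`. -/
def LInj (H : MorphismProperty C) : Subcat C where
  obj X := ∀ ⦃A A' : C⦄ (h : A ⟶ A'), H h → KanInjectiveObj h X
  hom X Y p := (∀ ⦃A A' : C⦄ (h : A ⟶ A'), H h → KanInjectiveObj h X) ∧
    (∀ ⦃A A' : C⦄ (h : A ⟶ A'), H h → KanInjectiveObj h Y) ∧
    ∀ ⦃A A' : C⦄ (h : A ⟶ A'), H h → KanInjectiveHom h p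
  dom _ _ _ hf := hf.1
  cod _ _ _ hf := hf.2.1
  id X hX := ⟨hX, hX, fun _ _ h hh => ⟨hX h hh, hX h hh, fun f g hg => by simpa using hg⟩⟩
  comp _ _ _ p q hp hq := ⟨hp.1, hq.2.1, fun _ _ h hh => ⟨hp.1 h hh, hq.2.1 h hh, fun f g hg => by
    simpa using (hq.2.2 h hh).2.2 _ _ ((hp.2.2 h hh).2.2 f g hg)⟩⟩

/-! ### Kock-Zöberlein monads -/

/-- `T` is a Kock-Zöberlein monad on `C`: its functor is locally monotone, and `Tη ≤ ηT`. -/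
def IsKZMonad (T : Monad C) : Prop :=
  LocallyMonotone T.toFunctor ∧ ∀ X : C, T.map (T.η.app X) ≤ T.η.app (T.obj X)

/-- The subcategory `S` is KZ-monadic: it is the Eilenberg-Moore category of a Kock-Zöberlein
monad on `C`, i.e. isomorphic to it by an isomorphism of categories that commutes with the
forgetful functors to `C`. -/
def Subcat.IsKZMonadic (S : Subcat C) : Prop :=
  ∃ T : Monad C, IsKZMonad T ∧ ∃ e : IsoCat S.Obj T.Algebra, e.functor ⋙ T.forget = S.incl

/-- The subcategory `S` is reflective, and it is KZ-monadic for the monad that this induces: the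
inclusion has a left adjoint, the induced monad is a Kock-Zöberlein monad, and the comparison
functor from `S` to the Eilenberg-Moore category is an isomorphism of categories. -/
def Subcat.IsKZReflective (S : Subcat C) : Prop :=
  ∃ (F : C ⥤ S.Obj) (adj : F ⊣ S.incl), IsKZMonad adj.toMonad ∧
    ∃ e : IsoCat S.Obj adj.toMonad.Algebra, e.functor = Monad.comparison adj

/-! ### The Kan-injective reflection chain -/

/-- The connecting map `X_i ⟶ X_j` of a transfinite chain. -/
abbrev conn (X : Ordinal.{v} ⥤ C) {i j : Ordinal.{v}} (hij : i ≤ j) : X.obj i ⟶ X.obj j :=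
  X.map (homOfLE hij)

/-- A Kan-injective reflection chain of `X₀` with respect to `H`. An ordinal is even iff it is of
the form `2 * j`, i.e. it is `0` or a limit ordinal plus `2 * n` with `n` finite.
* `X_0` is `X₀`, and `X_i` is the conical colimit of `X_j`, `j < i`, for limit ordinals `i`.
* For `i` even, `X_{i+1}` is the conical colimit of the diagram of all spans `f : A ⟶ X_i`,
  `h : A ⟶ A'` with `h` in `H`; the colimit morphisms are the connecting map and `slash h f`.
* For `i` even, `X_{i+1} ⟶ X_{i+2}` is the universal morphism such that the inequality
  `slash h f ≤ g` holds in `X_{i+2}` for all `h : A ⟶ A'` in `H`, `f : A ⟶ X_j`, `j ≤ i` even, and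
  `g : A' ⟶ X_{i+1}` such that `f ≤ h ≫ g` holds in `X_{i+1}`. -/
structure KanReflectionChain (H : MorphismProperty C) (X₀ : C) where
  X : Ordinal.{v} ⥤ C
  zeroIso : X₀ ≅ X.obj 0
  limit_isColimit : X.IsWellOrderContinuous
  limit_orderEpi : ∀ i : Ordinal.{v}, Order.IsSuccLimit i → ∀ ⦃Z : C⦄ (a b : X.obj i ⟶ Z),
    (∀ (j : Ordinal.{v}) (hj : j < i), conn X hj.le ≫ a ≤ conn X hj.le ≫ b) → a ≤ b
  slash : ∀ ⦃i : Ordinal.{v}⦄, 2 ∣ i → ∀ ⦃A A' : C⦄ (h : A ⟶ A'), H h → (A ⟶ X.obj i) →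
    (A' ⟶ X.obj (i + 1))
  slash_comm : ∀ ⦃i : Ordinal.{v}⦄ (hi : 2 ∣ i) ⦃A A' : C⦄ (h : A ⟶ A') (hh : H h)
    (f : A ⟶ X.obj i), h ≫ slash hi h hh f = f ≫ conn X le_self_add
  odd_existsUnique : ∀ ⦃i : Ordinal.{v}⦄ (hi : 2 ∣ i) ⦃Z : C⦄ (p : X.obj i ⟶ Z)
    (q : ∀ ⦃A A' : C⦄ (h : A ⟶ A'), H h → (A ⟶ X.obj i) → (A' ⟶ Z)),
    (∀ ⦃A A' : C⦄ (h : A ⟶ A') (hh : H h) (f : A ⟶ X.obj i), h ≫ q h hh f = f ≫ p) →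
    ∃! r : X.obj (i + 1) ⟶ Z, conn X le_self_add ≫ r = p ∧
      ∀ ⦃A A' : C⦄ (h : A ⟶ A') (hh : H h) (f : A ⟶ X.obj i), slash hi h hh f ≫ r = q h hh f
  odd_orderEpi : ∀ ⦃i : Ordinal.{v}⦄ (hi : 2 ∣ i) ⦃Z : C⦄ (a b : X.obj (i + 1) ⟶ Z),
    conn X (le_self_add : i ≤ i + 1) ≫ a ≤ conn X (le_self_add : i ≤ i + 1) ≫ b →
    (∀ ⦃A A' : C⦄ (h : A ⟶ A') (hh : H h) (f : A ⟶ X.obj i),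
      slash hi h hh f ≫ a ≤ slash hi h hh f ≫ b) → a ≤ b
  even_le : ∀ ⦃i : Ordinal.{v}⦄, 2 ∣ i → ∀ ⦃j : Ordinal.{v}⦄ (hj : 2 ∣ j) (hji : j ≤ i)
    ⦃A A' : C⦄ (h : A ⟶ A') (hh : H h) (f : A ⟶ X.obj j) (g : A' ⟶ X.obj (i + 1)),
    f ≫ conn X (hji.trans le_self_add) ≤ h ≫ g →
    slash hj h hh f ≫ conn X (add_le_add_left hji 1) ≫ conn X (le_self_add : i + 1 ≤ i + 1 + 1) ≤
      g ≫ conn X (le_self_add : i + 1 ≤ i + 1 + 1)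
  even_existsUnique : ∀ ⦃i : Ordinal.{v}⦄, 2 ∣ i → ∀ ⦃Z : C⦄ (d : X.obj (i + 1) ⟶ Z),
    (∀ ⦃j : Ordinal.{v}⦄ (hj : 2 ∣ j) (hji : j ≤ i)
      ⦃A A' : C⦄ (h : A ⟶ A') (hh : H h) (f : A ⟶ X.obj j) (g : A' ⟶ X.obj (i + 1)),
      f ≫ conn X (hji.trans le_self_add) ≤ h ≫ g →
      slash hj h hh f ≫ conn X (add_le_add_left hji 1) ≫ d ≤ g ≫ d) →
    ∃! r : X.obj (i + 1 + 1) ⟶ Z, conn X le_self_add ≫ r = d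
  even_orderEpi : ∀ ⦃i : Ordinal.{v}⦄, 2 ∣ i →
    IsOrderEpi (conn X (le_self_add : i + 1 ≤ i + 1 + 1))

/-- All `(E, M)`-factorizations of the connecting maps `X_i ⟶ X_j` with `j ≥ s` have the same
`E`-part, i.e. they represent the same quotient of `X_i`. -/
def QuotientsStabilizeAt (E M : MorphismProperty C) (X : Ordinal.{v} ⥤ C)
    (i s : Ordinal.{v}) : Prop :=
  ∃ (Q : C) (e : X.obj i ⟶ Q), E e ∧ ∀ ⦃j : Ordinal.{v}⦄ (hij : i ≤ j), s ≤ j →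
    ∃ m : Q ⟶ X.obj j, M m ∧ e ≫ m = conn X hij

/-- A function `φ` on ordinals given by Reiterman's trick for the chain `X`: `φ 0 = 0`; `φ (i + 1)`
is an even ordinal above `φ i` from which on all connecting maps out of `X_{φ i}` represent the
same quotient of `X_{φ i}`; and `φ i` is the supremum of the `φ j`, `j < i`, for limit
ordinals `i`. -/
structure IsReitermanFunction (E M : MorphismProperty C) (X : Ordinal.{v} ⥤ C)
    (φ : Ordinal.{v} → Ordinal.{v}) : Prop where
  zero : φ 0 = 0
  lt_succ : ∀ i, φ i < φ (i + 1)
  even_succ : ∀ i, 2 ∣ φ (i + 1)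
  stabilizes : ∀ i, QuotientsStabilizeAt E M X (φ i) (φ (i + 1))
  limit : ∀ i, Order.IsSuccLimit i → IsLUB (φ '' Set.Iio i) (φ i)

end Kan

end KanInj

open KanInj

/-!
# Left Kan-injectivity subcategories are KZ-monadic

The reflection of `X₀` in `LInj H` is a stage of a chain that freely adds left Kan extensions
along the members of `H`. The odd stages add a formal extension `slash h f` of every
`f : A ⟶ X_i`; the even stages force these formal extensions to be below every competitor that
exists so far.

*The chain exists.* Weighted colimits provide both steps (`exists_colimit_spans` and
`exists_coinserter_family`), and all conical colimits are jointly order-epic (`le_of_isColimit`).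
An even step refers to the whole history of the chain. To make it a function of the preceding
stage alone, the stages carry the set of pairs `(f, slash h f)` that have arisen so far
(`MarkedObj`). The recursion itself is `exists_transfinite_chain`.

*The chain is universal.* Every morphism from `X₀` to a left Kan-injective object `P` extends to
each stage `X_i` so that the formal extensions become left Kan extensions in `P`
(`exists_preservesSlash`). If `q` is such an extension and `p : X_i ⟶ P` any morphism, then
`q ≤ p` holds as soon as it holds on `X₀` (`PreservesSlash.le`). This gives the uniqueness of the
extension, and it is also the two-dimensional property that makes the induced monad a
Kock-Zöberlein monad.

*Some stage is left Kan-injective.* Cowellpoweredness makes the images of each `X_i` in the later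
stages constant from some stage on, which yields Reiterman functions `φ`. For a limit ordinal `l`,
the images of the `X_{φ a}`, `a < l`, in `X_{φ l}` form a chain of subobjects with union
`X_{φ l}`, and each of them lies already in `X_{φ (a + 1)}` (`exists_imageChain`). If `l` comes
from a rank (see `exists_isSmallAt` for its choice), morphisms from domains and codomains of
members of `H` factorize through these images. As the images are order-subobjects, also the
inequalities between such morphisms hold before the stage `X_{φ l}`, so that the formal extensions
are left Kan extensions there (`isLan_slash`), and `X_{φ l}` is a reflection (`isReflection`).

*Algebras.* For an algebra `a : T A ⟶ A` of the induced monad, `a` is left adjoint to the unit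
(`le_structureMap_unit`). Hence `a` preserves left Kan extensions, and those of `A` are computed
in `T A`. So algebras and their homomorphisms are the objects and morphisms of `LInj H`, and the
structure morphism is unique.
-/

namespace KanInj

open Limits

/-! ### Colimits in order-enriched categories -/

section Order

variable {C : Type u} [Category.{v} C] [OrderEnriched C]

lemma comp_le_comp_left {X Y Z : C} (f : X ⟶ Y) {g g' : Y ⟶ Z} (hg : g ≤ g') :
    f ≫ g ≤ f ≫ g' :=
  OrderEnriched.comp_mono (le_refl f) hg

lemma comp_le_comp_right {X Y Z : C} {f f' : X ⟶ Y} (hf : f ≤ f') (g : Y ⟶ Z) :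
    f ≫ g ≤ f' ≫ g :=
  OrderEnriched.comp_mono hf (le_refl g)

end Order

/-- The order-enrichment of a category in which distinct parallel morphisms are incomparable. -/
abbrev discreteOrderEnriched (D : Type u) [Category.{v} D] : OrderEnriched D where
  homOrder _ _ :=
    { le := Eq
      le_refl := fun _ => rfl
      le_trans := fun _ _ _ => Eq.trans
      le_antisymm := fun _ _ h _ => h }
  comp_mono := by
    rintro _ _ _ _ _ _ _ rfl rfl
    rfl

section Colimits

variable {C : Type u} [Category.{v} C] [OrderEnriched C]

/-- Ordinary colimits are the colimits weighted by the constant weight at the one-point poset; as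
weighted colimits they are in addition jointly order-epic. -/
lemma HasWeightedColimits.exists_colimit (hC : HasWeightedColimits C) {D : Type v}
    [Category.{v} D] (F : D ⥤ C) :
    ∃ c : Cocone F, Nonempty (IsColimit c) ∧
      ∀ ⦃Z : C⦄ (f g : c.pt ⟶ Z), (∀ d, c.ι.app d ≫ f ≤ c.ι.app d ≫ g) → f ≤ g := by
  let _ := discreteOrderEnriched D
  obtain ⟨L, t, ht⟩ := hC D F ((Functor.const _).obj (PartOrd.of PUnit.{v + 1}))
    (fun X Y f g h => by obtain rfl : f = g := h; exact le_rfl)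
    (fun X Y f g h => le_rfl)
  let c : Cocone F :=
    { pt := L
      ι := { app := fun d => t.app d PUnit.unit
             naturality := fun d d' g => by simpa using! (t.naturality g PUnit.unit).symm } }
  let w (s : Cocone F) : WeightedCocone F ((Functor.const _).obj (PartOrd.of PUnit.{v + 1})) s.pt :=
    { app := fun d _ => s.ι.app d
      monotone := fun d _ _ _ => le_rfl
      naturality := fun d d' g x => (s.w g).symm }
  refine ⟨c, ⟨IsColimit.ofExistsUnique fun s => ?_⟩, fun Z f g h => ht.le_of_le f g fun d _ => h d⟩
  obtain ⟨f, hf, hu⟩ := ht.existsUnique (w s)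
  exact ⟨f, fun d => hf d PUnit.unit, fun g hg => hu g fun d _ => hg d⟩

lemma HasWeightedColimits.hasColimitsOfSize (hC : HasWeightedColimits C) :
    HasColimitsOfSize.{v, v} C where
  has_colimits_of_shape D _ :=
    { has_colimit := fun F => by
        obtain ⟨c, ⟨hc⟩, -⟩ := hC.exists_colimit F
        exact ⟨⟨c, hc⟩⟩ }

lemma HasWeightedColimits.hasColimitsOfShape (hC : HasWeightedColimits C) (D : Type w)
    [Category.{w'} D] [EssentiallySmall.{v} D] : HasColimitsOfShape D C :=
  have := hC.hasColimitsOfSize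
  hasColimitsOfShape_of_equivalence (equivSmallModel.{v} D).symm

/-- Every colimit cocone over an essentially small diagram is jointly order-epic. -/
lemma HasWeightedColimits.le_of_isColimit (hC : HasWeightedColimits C) {D : Type w}
    [Category.{w'} D] [EssentiallySmall.{v} D] {F : D ⥤ C} {c : Cocone F} (hc : IsColimit c)
    ⦃Z : C⦄ (f g : c.pt ⟶ Z) (h : ∀ d, c.ι.app d ≫ f ≤ c.ι.app d ≫ g) : f ≤ g := by
  obtain ⟨c', ⟨hc'⟩, h'⟩ := hC.exists_colimit ((equivSmallModel.{v} D).inverse ⋙ F)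
  let i := hc'.coconePointUniqueUpToIso (hc.whiskerEquivalence (equivSmallModel.{v} D).symm)
  have hi : ∀ d, c'.ι.app d ≫ i.hom = c.ι.app ((equivSmallModel.{v} D).inverse.obj d) := fun d =>
    hc'.comp_coconePointUniqueUpToIso_hom _ d
  have := h' (i.hom ≫ f) (i.hom ≫ g) fun d => by
    simp only [← Category.assoc, hi]
    exact h _
  simpa using comp_le_comp_left i.inv this

/-- The coinserter of a pair of parallel morphisms `u`, `v`: the universal morphism `d` with
`u ≫ d ≤ v ≫ d`. The weight on the parallel pair is the inclusion of the two points into the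
two-element chain. -/
lemma HasWeightedColimits.exists_coinserter (hC : HasWeightedColimits C) {B X : C} (a b : B ⟶ X) :
    ∃ (Y : C) (d : X ⟶ Y), a ≫ d ≤ b ≫ d ∧ IsOrderEpi d ∧
      ∀ ⦃Z : C⦄ (e : X ⟶ Z), a ≫ e ≤ b ≫ e → ∃! r : Y ⟶ Z, d ≫ r = e := by
  let _ := discreteOrderEnriched (AsSmall.{v} WalkingParallelPair)
  let pt (x : Bool) : PartOrd.of PUnit.{v + 1} ⟶ PartOrd.of (ULift.{v} Bool) :=
    PartOrd.ofHom ⟨fun _ => ⟨x⟩, fun _ _ _ => le_rfl⟩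
  let W : (AsSmall.{v} WalkingParallelPair)ᵒᵖ ⥤ PartOrd.{v} :=
    AsSmall.down.op ⋙ (parallelPair (pt false).op (pt true).op).leftOp
  let F : AsSmall.{v} WalkingParallelPair ⥤ C := AsSmall.down ⋙ parallelPair a b
  obtain ⟨L, t, ht⟩ := hC _ F W
    (fun X Y f g h => by obtain rfl : f = g := h; exact le_rfl)
    (fun X Y f g h => by obtain rfl : f = g := Quiver.Hom.unop_inj h; exact le_rfl)
  let o : AsSmall.{v} WalkingParallelPair := ⟨.one⟩
  let z : AsSmall.{v} WalkingParallelPair := ⟨.zero⟩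
  let d : X ⟶ L := t.app o PUnit.unit
  have hl : t.app z ⟨false⟩ = a ≫ d :=
    t.naturality (d := z) (d' := o) ⟨WalkingParallelPairHom.left⟩ PUnit.unit
  have hr : t.app z ⟨true⟩ = b ≫ d :=
    t.naturality (d := z) (d' := o) ⟨WalkingParallelPairHom.right⟩ PUnit.unit
  have key : ∀ ⦃Z : C⦄ (f g : L ⟶ Z), d ≫ f ≤ d ≫ g →
      ∀ (k : AsSmall.{v} WalkingParallelPair) (x : W.obj (op k)),
        t.app k x ≫ f ≤ t.app k x ≫ g := by
    rintro Z f g h ⟨_ | _⟩ x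
    · obtain ⟨_ | _⟩ : ULift.{v} Bool := x
      · have := comp_le_comp_left a h
        rw [← Category.assoc, ← Category.assoc, ← hl] at this
        exact this
      · have := comp_le_comp_left b h
        rw [← Category.assoc, ← Category.assoc, ← hr] at this
        exact this
    · exact h
  refine ⟨L, d, ?_, fun Z f g h => ht.le_of_le f g (key f g h), fun Z e he => ?_⟩
  · rw [← hl, ← hr]
    exact t.monotone z (show (⟨false⟩ : ULift.{v} Bool) ≤ ⟨true⟩ from Bool.false_le _)
  · let s : WeightedCocone F W Z :=
      { app := fun k => match k with
          | ⟨.zero⟩ => fun x : ULift.{v} Bool => cond x.down (b ≫ e) (a ≫ e)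
          | ⟨.one⟩ => fun _ => e
        monotone := by
          rintro ⟨_ | _⟩ x y h
          · obtain ⟨_ | _⟩ : ULift.{v} Bool := x <;> obtain ⟨_ | _⟩ : ULift.{v} Bool := y
            · exact le_rfl
            · exact he
            · exact absurd (show true ≤ false from h) (by decide)
            · exact le_rfl
          · exact le_rfl
        naturality := by
          rintro ⟨_ | _⟩ ⟨_ | _⟩ ⟨g⟩ x <;> change WalkingParallelPairHom _ _ at g <;> cases g
          · exact (Category.id_comp _).symm
          · rfl
          · rfl
          · exact (Category.id_comp _).symm }
    obtain ⟨r, hs, hu⟩ := ht.existsUnique s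
    refine ⟨r, hs o PUnit.unit, fun r' hr' => hu r' ?_⟩
    rintro ⟨_ | _⟩ x
    · obtain ⟨_ | _⟩ : ULift.{v} Bool := x
      · exact (congrArg (· ≫ r') hl).trans ((Category.assoc _ _ _).trans (congrArg (a ≫ ·) hr'))
      · exact (congrArg (· ≫ r') hr).trans ((Category.assoc _ _ _).trans (congrArg (b ≫ ·) hr'))
    · exact hr'

/-- Coinserters of a small family of pairs of morphisms with common codomain. -/
lemma HasWeightedColimits.exists_coinserter_family (hC : HasWeightedColimits C) {K : Type w}
    [Small.{v} K] {X : C} (B : K → C) (a b : ∀ k, B k ⟶ X) :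
    ∃ (Y : C) (d : X ⟶ Y), (∀ k, a k ≫ d ≤ b k ≫ d) ∧ IsOrderEpi d ∧
      ∀ ⦃Z : C⦄ (e : X ⟶ Z), (∀ k, a k ≫ e ≤ b k ≫ e) → ∃! r : Y ⟶ Z, d ≫ r = e := by
  have := hC.hasColimitsOfShape (Discrete K)
  obtain ⟨Y, d, h₁, h₂, h₃⟩ := hC.exists_coinserter (Sigma.desc a) (Sigma.desc b)
  refine ⟨Y, d, fun k => ?_, h₂, fun Z e he => h₃ e ?_⟩
  · simpa using comp_le_comp_left (Sigma.ι B k) h₁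
  · refine hC.le_of_isColimit (coproductIsCoproduct B) _ _ fun ⟨k⟩ => ?_
    simpa using! he k

/-- The colimit of a small family of spans with a common foot `X`. -/
lemma HasWeightedColimits.exists_colimit_spans (hC : HasWeightedColimits C) {K : Type w}
    [Small.{v} K] {X : C} (A A' : K → C) (h : ∀ k, A k ⟶ A' k) (f : ∀ k, A k ⟶ X) :
    ∃ (Y : C) (x : X ⟶ Y) (s : ∀ k, A' k ⟶ Y), (∀ k, h k ≫ s k = f k ≫ x) ∧
      (∀ ⦃Z : C⦄ (p : X ⟶ Z) (q : ∀ k, A' k ⟶ Z), (∀ k, h k ≫ q k = f k ≫ p) →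
        ∃! r : Y ⟶ Z, x ≫ r = p ∧ ∀ k, s k ≫ r = q k) ∧
      ∀ ⦃Z : C⦄ (a b : Y ⟶ Z), x ≫ a ≤ x ≫ b → (∀ k, s k ≫ a ≤ s k ≫ b) → a ≤ b := by
  have := hC.hasColimitsOfShape (Discrete K)
  have := hC.hasColimitsOfShape WalkingSpan
  refine ⟨pushout (Sigma.desc f) (Limits.Sigma.map h), pushout.inl _ _,
    fun k => Sigma.ι A' k ≫ pushout.inr _ _, fun k => ?_, fun Z p q hpq => ?_,
    fun Z a b h₁ h₂ => ?_⟩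
  · have := Sigma.ι A k ≫= pushout.condition (f := Sigma.desc f) (g := Limits.Sigma.map h)
    simpa using this.symm
  · have w : Sigma.desc f ≫ p = Limits.Sigma.map h ≫ Sigma.desc q :=
      Sigma.hom_ext _ _ fun k => by simp [hpq]
    refine ⟨pushout.desc p (Sigma.desc q) w, ⟨pushout.inl_desc _ _ _, fun k => ?_⟩,
      fun r ⟨hr₁, hr₂⟩ => ?_⟩
    · rw [Category.assoc, pushout.inr_desc, Sigma.ι_desc]
    apply pushout.hom_ext
    · rw [hr₁, pushout.inl_desc]
    · refine Sigma.hom_ext _ _ fun k => ?_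
      rw [pushout.inr_desc, Sigma.ι_desc, ← hr₂ k, Category.assoc]
  · have h₃ : pushout.inr (Sigma.desc f) (Limits.Sigma.map h) ≫ a ≤ pushout.inr _ _ ≫ b :=
      hC.le_of_isColimit (coproductIsCoproduct A') _ _ fun ⟨k⟩ => by simpa using! h₂ k
    refine hC.le_of_isColimit (pushoutIsPushout (Sigma.desc f) (Limits.Sigma.map h)) _ _ ?_
    rintro (_ | _ | _)
    · have := comp_le_comp_left (Sigma.desc f) h₁
      rw [← Category.assoc, ← Category.assoc] at this
      exact this
    · exact h₁
    · exact h₃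

end Colimits

/-! ### Transfinite chains -/

section Parity

lemma two_dvd_of_isSuccLimit {i : Ordinal.{v}} (hi : Order.IsSuccLimit i) : 2 ∣ i := by
  have h : (2 : Ordinal.{v}) ∣ Ordinal.omega0 :=
    ⟨Ordinal.omega0, by simpa using (Ordinal.natCast_mul_omega0 (n := 2) (by norm_num)).symm⟩
  exact h.trans (Ordinal.isSuccPrelimit_iff_omega0_dvd.1 hi.isSuccPrelimit)

lemma not_two_dvd_add_one {i : Ordinal.{v}} (hi : 2 ∣ i) : ¬ 2 ∣ i + 1 := by
  rw [Ordinal.dvd_add_iff hi]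
  intro h
  exact absurd (Ordinal.le_of_dvd one_ne_zero h) (by norm_num)

lemma two_dvd_add_one_add_one {i : Ordinal.{v}} (hi : 2 ∣ i) : 2 ∣ i + 1 + 1 := by
  rw [add_assoc, Ordinal.dvd_add_iff hi, one_add_one_eq_two]

lemma exists_eq_add_one_of_not_two_dvd {i : Ordinal.{v}} (hi : ¬ 2 ∣ i) :
    ∃ j, 2 ∣ j ∧ i = j + 1 := by
  refine ⟨2 * (i / 2), ⟨_, rfl⟩, ?_⟩
  have h₁ : i % 2 < 2 := Ordinal.mod_lt i two_ne_zero
  have h₂ : i % 2 ≠ 0 := fun h => hi (Ordinal.dvd_of_mod_eq_zero h)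
  have h₃ : i % 2 = 1 := by
    exact le_antisymm (Order.lt_add_one_iff.1 (h₁.trans_eq one_add_one_eq_two.symm))
      (Order.one_le_iff_ne_zero.2 h₂)
  conv_lhs => rw [← Ordinal.div_add_mod i 2, h₃]

lemma two_dvd_add_one {i : Ordinal.{v}} (hi : ¬ 2 ∣ i) : 2 ∣ i + 1 := by
  obtain ⟨j, hj, rfl⟩ := exists_eq_add_one_of_not_two_dvd hi
  exact two_dvd_add_one_add_one hj

/-- Induction along the three kinds of stages of a Kan-injective reflection chain after the initial
one: odd stages, even successor stages and limit stages. -/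
lemma ordinal_parity_induction {P : Ordinal.{v} → Prop} (zero : P 0)
    (odd : ∀ i, 2 ∣ i → P i → P (i + 1)) (even : ∀ i, 2 ∣ i → P (i + 1) → P (i + 1 + 1))
    (limit : ∀ i, Order.IsSuccLimit i → (∀ j < i, P j) → P i) (i : Ordinal.{v}) : P i := by
  induction i using Ordinal.limitRecOn with
  | zero => exact zero
  | add_one i hi =>
    by_cases h : 2 ∣ i
    · exact odd i h hi
    · obtain ⟨j, hj, rfl⟩ := exists_eq_add_one_of_not_two_dvd h
      exact even j hj hi
  | limit i h hi => exact limit i h hi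

end Parity

section TransfiniteChain

open SmallObject

/-- If every object of `B` is the domain of a morphism in an isomorphism-invariant class `step`, and
`B` has colimits of chains indexed by small limit ordinals, then there is a continuous chain
indexed by all small ordinals whose successor maps belong to `step`.

The iteration of successor structures requires a colimit of the whole chain. This is provided by
passing to the opposite of the category of copresheaves on `B`, in which `B` embeds fully and
compatibly with colimits; all stages of the iteration remain representable. -/
theorem exists_transfinite_chain {B : Type u} [Category.{v} B] (step : MorphismProperty B)
    [step.RespectsIso] (hstep : ∀ X : B, ∃ (Y : B) (t : X ⟶ Y), step t)
    (hlim : ∀ i : Ordinal.{v}, Order.IsSuccLimit i → HasColimitsOfShape (Set.Iio i) B) (X₀ : B) :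
    ∃ F : Ordinal.{v} ⥤ B, Nonempty (X₀ ≅ F.obj 0) ∧ F.IsWellOrderContinuous ∧
      ∀ i : Ordinal.{v}, step (F.map (homOfLE (le_self_add : i ≤ i + 1))) := by
  let y : B ⥤ (B ⥤ Type (v + 1))ᵒᵖ := uliftCoyoneda.{v + 1}.rightOp
  have hpres (i : Ordinal.{v}) : PreservesColimitsOfShape (Set.Iio i) y :=
    preservesColimitsOfShape_rightOp _ _
  have hy : y.FullyFaithful := (Coyoneda.ULiftCoyoneda.fullyFaithful.{v + 1} B).rightOp
  have := hy.full
  have := hy.faithful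
  -- Outside the representables the successor is irrelevant; there it is the identity.
  have hsucc (Z : (B ⥤ Type (v + 1))ᵒᵖ) : ∃ (W : (B ⥤ Type (v + 1))ᵒᵖ) (t : Z ⟶ W),
      ∀ (X : B) (e : y.obj X ≅ Z), ∃ (Y : B) (t' : X ⟶ Y) (e' : y.obj Y ≅ W),
        step t' ∧ y.map t' ≫ e'.hom = e.hom ≫ t := by
    by_cases h : ∃ X, Nonempty (y.obj X ≅ Z)
    · obtain ⟨X₁, ⟨e₁⟩⟩ := h
      obtain ⟨Y, t, ht⟩ := hstep X₁
      refine ⟨y.obj Y, e₁.inv ≫ y.map t, fun X e => ?_⟩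
      refine ⟨Y, (hy.preimageIso (e ≪≫ e₁.symm)).hom ≫ t, Iso.refl _,
        MorphismProperty.RespectsIso.precomp _ _ _ ht, ?_⟩
      simp
    · exact ⟨Z, 𝟙 Z, fun X e => (h ⟨X, ⟨e⟩⟩).elim⟩
  choose succ toSucc hsucc using hsucc
  let Φ : SuccStruct (B ⥤ Type (v + 1))ᵒᵖ := ⟨y.obj X₀, succ, toSucc⟩
  let G := Φ.iterationFunctor Ordinal.{v}
  have hGsucc (i : Ordinal.{v}) : ∃ a : succ (G.obj i) ≅ G.obj (i + 1),
      G.map (homOfLE (le_self_add : i ≤ i + 1)) = toSucc _ ≫ a.hom :=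
    ⟨(Φ.iterationFunctorObjSuccIso i (not_isMax i)).symm,
      Φ.iterationFunctor_map_succ i (not_isMax i)⟩
  have hG (i : Ordinal.{v}) : y.essImage (G.obj i) := by
    induction i using Ordinal.limitRecOn with
    | zero => exact ⟨X₀, ⟨(Φ.iterationFunctorObjBotIso Ordinal.{v}).symm⟩⟩
    | add_one i hi =>
      obtain ⟨X, ⟨e⟩⟩ := hi
      obtain ⟨a, -⟩ := hGsucc i
      obtain ⟨Y, -, e', -⟩ := hsucc _ X e
      exact ⟨Y, ⟨e' ≪≫ a⟩⟩
    | limit i h hi =>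
      have := hlim i h
      let G' := (Set.principalSegIio i).monotone.functor ⋙ G
      have hG' : ∀ j, y.essImage (G'.obj j) := fun j => hi j.1 j.2
      let e := Functor.essImage.liftFunctorCompIso G' y hG'
      let c := colimit.cocone (Functor.essImage.liftFunctor G' y hG')
      have hc : IsColimit (y.mapCocone c) := isColimitOfPreserves y (colimit.isColimit _)
      exact ⟨c.pt, ⟨hc.coconePointsIsoOfNatIso (G.isColimitOfIsWellOrderContinuous i h) e⟩⟩
  let F := Functor.essImage.liftFunctor G y hG
  let e : F ⋙ y ≅ G := Functor.essImage.liftFunctorCompIso G y hG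
  refine ⟨F, ⟨hy.preimageIso ((e.app 0 ≪≫ Φ.iterationFunctorObjBotIso Ordinal.{v}).symm)⟩, ?_, ?_⟩
  · have := Functor.isWellOrderContinuous_of_iso e.symm
    exact ⟨fun i hi => ⟨isColimitOfReflects y
      ((F ⋙ y).isColimitOfIsWellOrderContinuous i hi)⟩⟩
  · intro i
    obtain ⟨a, ha⟩ := hGsucc i
    obtain ⟨Y, t, e', ht, h⟩ := hsucc _ (F.obj i) (e.app i)
    have : F.map (homOfLE (le_self_add : i ≤ i + 1)) =
        t ≫ (hy.preimageIso (e' ≪≫ a ≪≫ (e.app (i + 1)).symm)).hom := by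
      apply hy.map_injective
      have := e.hom.naturality (homOfLE (le_self_add : i ≤ i + 1))
      rw [ha] at this
      simp only [Functor.comp_map] at this
      rw [← cancel_mono (e.hom.app (i + 1)), this, Functor.map_comp,
        Functor.FullyFaithful.preimageIso_hom, hy.map_preimage]
      simp [reassoc_of% h]
    rw [this]
    exact MorphismProperty.RespectsIso.postcomp _ _ _ ht

end TransfiniteChain

/-! ### Marked objects and the steps of the chain -/

section MarkedObjects

/-- An object of `C` together with an ordinal (the stage of the chain at which it occurs) and a
relation that records, for morphisms `h : A ⟶ A'`, pairs `f : A ⟶ pt`, `f' : A' ⟶ pt`, where `f'` is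
meant to become the left Kan extension of `f` along `h`. -/
structure MarkedObj (C : Type u) [Category.{v} C] where
  pt : C
  level : Ordinal.{v}
  rel : ∀ ⦃A A' : C⦄, (A ⟶ A') → (A ⟶ pt) → (A' ⟶ pt) → Prop

namespace MarkedObj

variable {C : Type u} [Category.{v} C]

/-- A morphism of marked objects: it does not lower the ordinal and preserves the marked pairs. -/
@[ext]
structure Hom (M N : MarkedObj C) where
  hom : M.pt ⟶ N.pt
  level_le : M.level ≤ N.level
  rel : ∀ ⦃A A' : C⦄ (h : A ⟶ A') (f : A ⟶ M.pt) (f' : A' ⟶ M.pt),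
    M.rel h f f' → N.rel h (f ≫ hom) (f' ≫ hom)

instance : Category.{v} (MarkedObj C) where
  Hom := Hom
  id M := ⟨𝟙 M.pt, le_rfl, fun _ _ _ f f' hf => by simpa using hf⟩
  comp a b := ⟨a.hom ≫ b.hom, a.level_le.trans b.level_le, fun _ _ h f f' hf => by
    simpa using b.rel h _ _ (a.rel h f f' hf)⟩
  id_comp _ := Hom.ext (Category.id_comp _)
  comp_id _ := Hom.ext (Category.comp_id _)
  assoc _ _ _ := Hom.ext (Category.assoc _ _ _)

@[ext]
lemma hom_ext {M N : MarkedObj C} {a b : M ⟶ N} (h : a.hom = b.hom) : a = b := Hom.ext h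

@[simp] lemma id_hom (M : MarkedObj C) : Hom.hom (𝟙 M) = 𝟙 M.pt := rfl

@[simp] lemma comp_hom {M N P : MarkedObj C} (a : M ⟶ N) (b : N ⟶ P) :
    (a ≫ b).hom = a.hom ≫ b.hom := rfl

variable (C) in
/-- The functor that forgets the ordinal and the marked pairs. -/
@[simps]
def forget : MarkedObj C ⥤ C where
  obj M := M.pt
  map a := a.hom

@[simp] lemma hom_inv_hom {M N : MarkedObj C} (a : M ≅ N) :
    a.hom.hom ≫ a.inv.hom = 𝟙 M.pt := by
  rw [← comp_hom, a.hom_inv_id, id_hom]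

@[simp] lemma inv_hom_hom {M N : MarkedObj C} (a : M ≅ N) :
    a.inv.hom ≫ a.hom.hom = 𝟙 N.pt := hom_inv_hom a.symm

@[simp] lemma hom_inv_hom_assoc {M N : MarkedObj C} (a : M ≅ N) {Z : C} (f : M.pt ⟶ Z) :
    a.hom.hom ≫ a.inv.hom ≫ f = f := by
  rw [← Category.assoc, hom_inv_hom, Category.id_comp]

@[simp] lemma inv_hom_hom_assoc {M N : MarkedObj C} (a : M ≅ N) {Z : C} (f : N.pt ⟶ Z) :
    a.inv.hom ≫ a.hom.hom ≫ f = f :=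
  hom_inv_hom_assoc a.symm f

lemma level_eq_of_iso {M N : MarkedObj C} (a : M ≅ N) : M.level = N.level :=
  le_antisymm a.hom.level_le a.inv.level_le

lemma rel_iff_of_iso {M N : MarkedObj C} (a : M ≅ N) ⦃A A' : C⦄ (h : A ⟶ A') (f : A ⟶ N.pt)
    (f' : A' ⟶ N.pt) : N.rel h f f' ↔ M.rel h (f ≫ a.inv.hom) (f' ≫ a.inv.hom) :=
  ⟨a.inv.rel h f f', fun hf => by simpa using a.hom.rel h _ _ hf⟩

section Colimit

variable {J : Type w} [Category.{w'} J] [Small.{v} J] [HasColimitsOfShape J C]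
  (K : J ⥤ MarkedObj C)

/-- The colimit of marked objects: the colimit in `C`, with the supremum of the ordinals and the
union of the images of the marked pairs. -/
noncomputable def colimitCocone : Cocone K where
  pt :=
    { pt := colimit (K ⋙ forget C)
      level := ⨆ j, (K.obj j).level
      rel := fun A A' h f f' => ∃ (j : J) (u : A ⟶ (K.obj j).pt) (u' : A' ⟶ (K.obj j).pt),
        (K.obj j).rel h u u' ∧ u ≫ colimit.ι (K ⋙ forget C) j = f ∧
          u' ≫ colimit.ι (K ⋙ forget C) j = f' }
  ι :=
    { app := fun j => ⟨colimit.ι (K ⋙ forget C) j,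
        Ordinal.le_iSup (fun j => (K.obj j).level) j, fun _ _ _ u u' hu => ⟨j, u, u', hu, rfl, rfl⟩⟩
      naturality := fun i j a => hom_ext (by simpa using! colimit.w (K ⋙ forget C) a) }

/-- The universal property of `colimitCocone`. -/
noncomputable def isColimitColimitCocone : IsColimit (colimitCocone K) where
  desc s :=
    { hom := colimit.desc (K ⋙ forget C) ((forget C).mapCocone s)
      level_le := Ordinal.iSup_le fun j => (s.ι.app j).level_le
      rel := by
        rintro A A' h _ _ ⟨j, u, u', hu, rfl, rfl⟩
        have hd {B : C} (x : B ⟶ (K.obj j).pt) : (x ≫ colimit.ι (K ⋙ forget C) j) ≫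
            colimit.desc (K ⋙ forget C) ((forget C).mapCocone s) = x ≫ (s.ι.app j).hom :=
          (Category.assoc _ _ _).trans
            (congrArg (x ≫ ·) (colimit.ι_desc ((forget C).mapCocone s) j))
        have := (s.ι.app j).rel h u u' hu
        rwa [← hd u, ← hd u'] at this }
  fac s j := hom_ext (colimit.ι_desc ((forget C).mapCocone s) j)
  uniq s m hm := hom_ext (colimit.hom_ext fun j =>
    (congrArg Hom.hom (hm j)).trans (colimit.ι_desc ((forget C).mapCocone s) j).symm)

instance : HasColimitsOfShape J (MarkedObj C) where
  has_colimit K := ⟨⟨_, isColimitColimitCocone K⟩⟩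

instance : PreservesColimit K (forget C) :=
  preservesColimit_of_preserves_colimit_cocone (isColimitColimitCocone K)
    (colimit.isColimit (K ⋙ forget C))

variable {K}

lemma level_of_isColimit {c : Cocone K} (hc : IsColimit c) :
    c.pt.level = ⨆ j, (K.obj j).level :=
  (level_eq_of_iso ((isColimitColimitCocone K).coconePointUniqueUpToIso hc)).symm

lemma exists_rel_of_isColimit {c : Cocone K} (hc : IsColimit c) ⦃A A' : C⦄ (h : A ⟶ A')
    (f : A ⟶ c.pt.pt) (f' : A' ⟶ c.pt.pt) (hf : c.pt.rel h f f') :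
    ∃ (j : J) (u : A ⟶ (K.obj j).pt) (u' : A' ⟶ (K.obj j).pt), (K.obj j).rel h u u' ∧
      u ≫ (c.ι.app j).hom = f ∧ u' ≫ (c.ι.app j).hom = f' := by
  let a := (isColimitColimitCocone K).coconePointUniqueUpToIso hc
  obtain ⟨j, u, u', hu, h₁, h₂⟩ := (rel_iff_of_iso a h f f').1 hf
  have ha : colimit.ι (K ⋙ forget C) j ≫ a.hom.hom = (c.ι.app j).hom :=
    congrArg Hom.hom ((isColimitColimitCocone K).comp_coconePointUniqueUpToIso_hom hc j)
  have key {B : C} (x : B ⟶ (K.obj j).pt) (y : B ⟶ c.pt.pt)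
      (hxy : x ≫ colimit.ι (K ⋙ forget C) j = y ≫ a.inv.hom) : x ≫ (c.ι.app j).hom = y := by
    rw [← ha]
    exact (Category.assoc _ _ _).symm.trans ((congrArg (· ≫ a.hom.hom) hxy).trans (by simp))
  exact ⟨j, u, u', hu, key u f h₁, key u' f' h₂⟩

end Colimit

section Steps

variable [OrderEnriched C] (H : MorphismProperty C)

/-- `t : M ⟶ N` is the step from an even to an odd stage of a Kan-injective reflection chain: `N` is
the colimit of all spans with a leg in `H` and foot `M`, with colimit morphisms `t` and `s`, which
are marked in addition to the pairs that are already marked in `M`. -/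
structure IsOddStep {M N : MarkedObj C} (t : M ⟶ N)
    (s : ∀ ⦃A A' : C⦄ (h : A ⟶ A'), H h → (A ⟶ M.pt) → (A' ⟶ N.pt)) : Prop where
  comm : ∀ ⦃A A' : C⦄ (h : A ⟶ A') (hh : H h) (f : A ⟶ M.pt), h ≫ s h hh f = f ≫ t.hom
  existsUnique : ∀ ⦃Z : C⦄ (p : M.pt ⟶ Z)
    (q : ∀ ⦃A A' : C⦄ (h : A ⟶ A'), H h → (A ⟶ M.pt) → (A' ⟶ Z)),
    (∀ ⦃A A' : C⦄ (h : A ⟶ A') (hh : H h) (f : A ⟶ M.pt), h ≫ q h hh f = f ≫ p) →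
    ∃! r : N.pt ⟶ Z, t.hom ≫ r = p ∧
      ∀ ⦃A A' : C⦄ (h : A ⟶ A') (hh : H h) (f : A ⟶ M.pt), s h hh f ≫ r = q h hh f
  orderEpi : ∀ ⦃Z : C⦄ (a b : N.pt ⟶ Z), t.hom ≫ a ≤ t.hom ≫ b →
    (∀ ⦃A A' : C⦄ (h : A ⟶ A') (hh : H h) (f : A ⟶ M.pt), s h hh f ≫ a ≤ s h hh f ≫ b) → a ≤ b
  rel_iff : ∀ ⦃A A' : C⦄ (h : A ⟶ A') (f : A ⟶ N.pt) (f' : A' ⟶ N.pt),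
    N.rel h f f' ↔ (∃ u u', M.rel h u u' ∧ u ≫ t.hom = f ∧ u' ≫ t.hom = f') ∨
      ∃ (hh : H h) (u : A ⟶ M.pt), u ≫ t.hom = f ∧ s h hh u = f'

/-- `t : M ⟶ N` is the step from an odd to an even stage of a Kan-injective reflection chain: the
universal morphism that turns the second components of the marked pairs into lower bounds of all
candidates for a left Kan extension. -/
structure IsEvenStep {M N : MarkedObj C} (t : M ⟶ N) : Prop where
  le : ∀ ⦃A A' : C⦄ (h : A ⟶ A') (f : A ⟶ M.pt) (f' g : A' ⟶ M.pt), H h → M.rel h f f' →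
    f ≤ h ≫ g → f' ≫ t.hom ≤ g ≫ t.hom
  existsUnique : ∀ ⦃Z : C⦄ (d : M.pt ⟶ Z),
    (∀ ⦃A A' : C⦄ (h : A ⟶ A') (f : A ⟶ M.pt) (f' g : A' ⟶ M.pt), H h → M.rel h f f' →
      f ≤ h ≫ g → f' ≫ d ≤ g ≫ d) → ∃! r : N.pt ⟶ Z, t.hom ≫ r = d
  orderEpi : IsOrderEpi t.hom
  rel_iff : ∀ ⦃A A' : C⦄ (h : A ⟶ A') (f : A ⟶ N.pt) (f' : A' ⟶ N.pt),
    N.rel h f f' ↔ ∃ u u', M.rel h u u' ∧ u ≫ t.hom = f ∧ u' ≫ t.hom = f'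

/-- A successor step of a Kan-injective reflection chain. -/
structure IsStep {M N : MarkedObj C} (t : M ⟶ N) : Prop where
  level : N.level = M.level + 1
  odd : 2 ∣ M.level → ∃ s, IsOddStep H t s
  even : ¬ 2 ∣ M.level → IsEvenStep H t

variable {H}

lemma IsOddStep.conj_iso {M M' N N' : MarkedObj C} {t : M ⟶ N}
    {s : ∀ ⦃A A' : C⦄ (h : A ⟶ A'), H h → (A ⟶ M.pt) → (A' ⟶ N.pt)} (ht : IsOddStep H t s)
    (a : M' ≅ M) (b : N ≅ N') :
    IsOddStep H (a.hom ≫ t ≫ b.hom) (fun _ _ h hh f => s h hh (f ≫ a.hom.hom) ≫ b.hom.hom) where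
  comm A A' h hh f := by simp [reassoc_of% ht.comm h hh]
  existsUnique Z p q hpq := by
    obtain ⟨r, ⟨hr₁, hr₂⟩, hu⟩ := ht.existsUnique (a.inv.hom ≫ p)
      (fun _ _ h hh f => q h hh (f ≫ a.inv.hom)) fun A A' h hh f => by simp [hpq]
    refine ⟨b.inv.hom ≫ r, ⟨by simp [hr₁], fun A A' h hh f => by simp [hr₂]⟩, ?_⟩
    rintro r' ⟨h₁, h₂⟩
    rw [← hu (b.hom.hom ≫ r') ⟨by simp [← h₁], fun A A' h hh f => ?_⟩, inv_hom_hom_assoc]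
    simp [← h₂]
  orderEpi Z x y h₁ h₂ := by
    have := ht.orderEpi (b.hom.hom ≫ x) (b.hom.hom ≫ y)
      (by simpa using comp_le_comp_left a.inv.hom h₁) fun A A' h hh f => by
        simpa using h₂ h hh (f ≫ a.inv.hom)
    simpa using comp_le_comp_left b.inv.hom this
  rel_iff A A' h f f' := by
    rw [rel_iff_of_iso b, ht.rel_iff]
    refine or_congr ⟨?_, ?_⟩ ⟨?_, ?_⟩
    · rintro ⟨u, u', hu, h₁, h₂⟩
      refine ⟨u ≫ a.inv.hom, u' ≫ a.inv.hom, a.inv.rel h u u' hu, ?_, ?_⟩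
      · simp [reassoc_of% h₁]
      · simp [reassoc_of% h₂]
    · rintro ⟨u, u', hu, rfl, rfl⟩
      exact ⟨u ≫ a.hom.hom, u' ≫ a.hom.hom, a.hom.rel h u u' hu, by simp, by simp⟩
    · rintro ⟨hh, u, h₁, h₂⟩
      exact ⟨hh, u ≫ a.inv.hom, by simp [reassoc_of% h₁], by simp [h₂]⟩
    · rintro ⟨hh, u, rfl, rfl⟩
      exact ⟨hh, u ≫ a.hom.hom, by simp, by simp⟩

lemma IsEvenStep.conj_iso {M M' N N' : MarkedObj C} {t : M ⟶ N} (ht : IsEvenStep H t)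
    (a : M' ≅ M) (b : N ≅ N') : IsEvenStep H (a.hom ≫ t ≫ b.hom) where
  le A A' h f f' g hh hf hg := by
    have := ht.le h _ _ (g ≫ a.hom.hom) hh (a.hom.rel h f f' hf)
      (by simpa using comp_le_comp_right hg a.hom.hom)
    simpa using comp_le_comp_right this b.hom.hom
  existsUnique Z d hd := by
    obtain ⟨r, hr, hu⟩ := ht.existsUnique (a.inv.hom ≫ d) fun A A' h f f' g hh hf hg => by
      simpa using hd h _ _ (g ≫ a.inv.hom) hh (a.inv.rel h f f' hf)
        (by simpa using comp_le_comp_right hg a.inv.hom)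
    refine ⟨b.inv.hom ≫ r, by simp [hr], fun r' h₁ => ?_⟩
    rw [← hu (b.hom.hom ≫ r') (by simp [← h₁]), inv_hom_hom_assoc]
  orderEpi Z x y h := by
    have := ht.orderEpi (b.hom.hom ≫ x) (b.hom.hom ≫ y)
      (by simpa using comp_le_comp_left a.inv.hom h)
    simpa using comp_le_comp_left b.inv.hom this
  rel_iff A A' h f f' := by
    rw [rel_iff_of_iso b, ht.rel_iff]
    constructor
    · rintro ⟨u, u', hu, h₁, h₂⟩
      refine ⟨u ≫ a.inv.hom, u' ≫ a.inv.hom, a.inv.rel h u u' hu, ?_, ?_⟩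
      · simp [reassoc_of% h₁]
      · simp [reassoc_of% h₂]
    · rintro ⟨u, u', hu, rfl, rfl⟩
      exact ⟨u ≫ a.hom.hom, u' ≫ a.hom.hom, a.hom.rel h u u' hu, by simp, by simp⟩

lemma IsStep.conj_iso {M M' N N' : MarkedObj C} {t : M ⟶ N} (ht : IsStep H t)
    (a : M' ≅ M) (b : N ≅ N') : IsStep H (a.hom ≫ t ≫ b.hom) where
  level := by rw [← level_eq_of_iso b, ht.level, level_eq_of_iso a]
  odd h := by
    obtain ⟨s, hs⟩ := ht.odd (level_eq_of_iso a ▸ h)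
    exact ⟨_, hs.conj_iso a b⟩
  even h := (ht.even (level_eq_of_iso a ▸ h)).conj_iso a b

variable (H) in
/-- The class of all successor steps. -/
def stepProperty : MorphismProperty (MarkedObj C) := fun _ _ t => IsStep H t

instance : (stepProperty H).RespectsIso :=
  MorphismProperty.RespectsIso.mk _
    (fun e f hf => by simpa using! IsStep.conj_iso hf e (Iso.refl _))
    (fun e f hf => by simpa using! IsStep.conj_iso hf (Iso.refl _) e)

variable (H) in
lemma exists_step (hC : HasWeightedColimits C) [MorphismProperty.IsSmall.{v} H]
    (M : MarkedObj C) : ∃ (N : MarkedObj C) (t : M ⟶ N), stepProperty H t := by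
  by_cases hM : 2 ∣ M.level
  · obtain ⟨Y, x, s, h₁, h₂, h₃⟩ := hC.exists_colimit_spans
      (K := Σ a : H.toSet, (a.1.left ⟶ M.pt)) (X := M.pt) (fun k => k.1.1.left)
      (fun k => k.1.1.right) (fun k => k.1.1.hom) (fun k => k.2)
    let s' ⦃A A' : C⦄ (h : A ⟶ A') (hh : H h) (f : A ⟶ M.pt) : A' ⟶ Y := s ⟨⟨Arrow.mk h, hh⟩, f⟩
    let N : MarkedObj C :=
      { pt := Y
        level := M.level + 1
        rel := fun A A' h f f' => (∃ u u', M.rel h u u' ∧ u ≫ x = f ∧ u' ≫ x = f') ∨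
          ∃ (hh : H h) (u : A ⟶ M.pt), u ≫ x = f ∧ s' h hh u = f' }
    let t : M ⟶ N :=
      { hom := x
        level_le := le_self_add
        rel := fun A A' h f f' hf => Or.inl ⟨f, f', hf, rfl, rfl⟩ }
    refine ⟨N, t, rfl, fun _ => ⟨s', ?_, ?_, ?_, fun _ _ _ _ _ => Iff.rfl⟩, fun h => (h hM).elim⟩
    · exact fun A A' h hh f => h₁ ⟨⟨Arrow.mk h, hh⟩, f⟩
    · intro Z p q hpq
      obtain ⟨r, ⟨hr₁, hr₂⟩, hu⟩ := h₂ p (fun k => q k.1.1.hom k.1.2 k.2) fun k => hpq _ _ _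
      exact ⟨r, ⟨hr₁, fun A A' h hh f => hr₂ ⟨⟨Arrow.mk h, hh⟩, f⟩⟩,
        fun r' hr' => hu r' ⟨hr'.1, fun k => hr'.2 k.1.1.hom k.1.2 k.2⟩⟩
    · exact fun Z a b hab hs => h₃ a b hab fun k => hs k.1.1.hom k.1.2 k.2
  · obtain ⟨Y, d, h₁, h₂, h₃⟩ := hC.exists_coinserter_family
      (K := { k : Σ a : H.toSet, (a.1.left ⟶ M.pt) × (a.1.right ⟶ M.pt) × (a.1.right ⟶ M.pt) //
        M.rel k.1.1.hom k.2.1 k.2.2.1 ∧ k.2.1 ≤ k.1.1.hom ≫ k.2.2.2 }) (X := M.pt)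
      (fun k => k.1.1.1.right) (fun k => k.1.2.2.1) (fun k => k.1.2.2.2)
    let N : MarkedObj C :=
      { pt := Y
        level := M.level + 1
        rel := fun A A' h f f' => ∃ u u', M.rel h u u' ∧ u ≫ d = f ∧ u' ≫ d = f' }
    let t : M ⟶ N :=
      { hom := d
        level_le := le_self_add
        rel := fun A A' h f f' hf => ⟨f, f', hf, rfl, rfl⟩ }
    refine ⟨N, t, rfl, fun h => (hM h).elim, fun _ => ⟨?_, ?_, h₂, fun _ _ _ _ _ => Iff.rfl⟩⟩
    · exact fun A A' h f f' g hh hf hg => h₁ ⟨⟨⟨Arrow.mk h, hh⟩, f, f', g⟩, hf, hg⟩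
    · exact fun Z e he => h₃ e fun k => he _ _ _ _ k.1.1.2 k.2.1 k.2.2

end Steps

end MarkedObj

end MarkedObjects

/-! ### Existence of Kan-injective reflection chains -/

section ChainExistence

variable {C : Type u} [Category.{v} C]

lemma conn_comp (X : Ordinal.{v} ⥤ C) {i j k : Ordinal.{v}} (hij : i ≤ j) (hjk : j ≤ k) :
    conn X hij ≫ conn X hjk = conn X (hij.trans hjk) := by
  rw [← X.map_comp, homOfLE_comp]

lemma conn_comp_assoc (X : Ordinal.{v} ⥤ C) {i j k : Ordinal.{v}} (hij : i ≤ j) (hjk : j ≤ k)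
    {Z : C} (f : X.obj k ⟶ Z) :
    conn X hij ≫ conn X hjk ≫ f = conn X (hij.trans hjk) ≫ f := by
  rw [← Category.assoc, conn_comp]

lemma conn_refl (X : Ordinal.{v} ⥤ C) (i : Ordinal.{v}) : conn X (le_refl i) = 𝟙 _ :=
  X.map_id i

variable [OrderEnriched C]

open MarkedObj in
/-- Every object has a Kan-injective reflection chain. The chain is the underlying chain of a chain
of marked objects: at stage `i` the marked pairs are the images of all pairs `(f, slash h f)` that
arose before `i`, and these are what the universal property of the even stages refers to. -/
theorem exists_kanReflectionChain (hC : HasWeightedColimits C) (H : MorphismProperty C)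
    [MorphismProperty.IsSmall.{v} H] (X₀ : C) : Nonempty (KanReflectionChain H X₀) := by
  have hshape (i : Ordinal.{v}) : HasColimitsOfShape (Set.Iio i) C := hC.hasColimitsOfShape _
  obtain ⟨F, ⟨e₀⟩, hF, hstep⟩ := exists_transfinite_chain (stepProperty H) (exists_step H hC)
    (fun i _ => inferInstance) ⟨X₀, 0, fun _ _ _ _ _ => False⟩
  have hlevel (i : Ordinal.{v}) : (F.obj i).level = i := by
    induction i using Ordinal.limitRecOn with
    | zero => exact (level_eq_of_iso e₀).symm
    | add_one i hi => rw [(hstep i).level, hi]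
    | limit i hi ih =>
      refine (level_of_isColimit (F.isColimitOfIsWellOrderContinuous i hi)).trans ?_
      refine le_antisymm (Ordinal.iSup_le fun j => ?_) (le_of_forall_lt fun a ha => ?_)
      · exact (ih j.1 j.2).le.trans j.2.le
      · have ha' : a + 1 < i := hi.add_one_lt ha
        refine (Order.lt_add_one_iff.2 le_rfl).trans_le ((ih _ ha').ge.trans ?_)
        exact Ordinal.le_iSup
          (fun j : Set.Iio i => (((Set.principalSegIio i).monotone.functor ⋙ F).obj j).level)
          ⟨a + 1, ha'⟩
  have hodd (i : Ordinal.{v}) (hi : 2 ∣ i) : ∃ s, IsOddStep H (F.map (homOfLE le_self_add)) s :=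
    (hstep i).odd (by rwa [hlevel])
  choose s hs using hodd
  have heven (i : Ordinal.{v}) (hi : 2 ∣ i) :
      IsEvenStep H (F.map (homOfLE (le_self_add : i + 1 ≤ i + 1 + 1))) :=
    (hstep (i + 1)).even (by rw [hlevel]; exact not_two_dvd_add_one hi)
  let X : Ordinal.{v} ⥤ C := F ⋙ forget C
  have hrel (i : Ordinal.{v}) : ∀ ⦃A A' : C⦄ (h : A ⟶ A') (f : A ⟶ X.obj i) (f' : A' ⟶ X.obj i),
      (F.obj i).rel h f f' → ∃ (j : Ordinal.{v}) (hj : 2 ∣ j) (hji : j + 1 ≤ i) (hh : H h)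
        (u : A ⟶ X.obj j), u ≫ conn X (le_self_add.trans hji) = f ∧
          s j hj h hh u ≫ conn X hji = f' := by
    induction i using ordinal_parity_induction with
    | zero => exact fun A A' h f f' hf => ((rel_iff_of_iso e₀ h f f').1 hf).elim
    | odd i hi ih =>
      intro A A' h f f' hf
      obtain ⟨u, u', hu, rfl, rfl⟩ | ⟨hh, u, rfl, rfl⟩ := ((hs i hi).rel_iff h f f').1 hf
      · obtain ⟨j, hj, hji, hh, w, rfl, rfl⟩ := ih h u u' hu
        refine ⟨j, hj, hji.trans le_self_add, hh, w, ?_, ?_⟩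
        · exact (congrArg (w ≫ ·) (conn_comp X _ _).symm).trans (Category.assoc _ _ _).symm
        · exact (congrArg (_ ≫ ·) (conn_comp X _ _).symm).trans (Category.assoc _ _ _).symm
      · exact ⟨i, hi, le_rfl, hh, u, rfl,
          (congrArg (s i hi h hh u ≫ ·) (conn_refl X (i + 1))).trans (Category.comp_id _)⟩
    | even i hi ih =>
      intro A A' h f f' hf
      obtain ⟨u, u', hu, rfl, rfl⟩ := ((heven i hi).rel_iff h f f').1 hf
      obtain ⟨j, hj, hji, hh, w, rfl, rfl⟩ := ih h u u' hu
      refine ⟨j, hj, hji.trans le_self_add, hh, w, ?_, ?_⟩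
      · exact (congrArg (w ≫ ·) (conn_comp X _ _).symm).trans (Category.assoc _ _ _).symm
      · exact (congrArg (_ ≫ ·) (conn_comp X _ _).symm).trans (Category.assoc _ _ _).symm
    | limit i hi ih =>
      intro A A' h f f' hf
      obtain ⟨⟨k, hk⟩, u, u', hu, rfl, rfl⟩ :=
        exists_rel_of_isColimit (F.isColimitOfIsWellOrderContinuous i hi) h f f' hf
      obtain ⟨j, hj, hji, hh, w, rfl, rfl⟩ := ih k hk h u u' hu
      refine ⟨j, hj, hji.trans (le_of_lt hk), hh, w, ?_, ?_⟩
      · exact (congrArg (w ≫ ·) (conn_comp X _ _).symm).trans (Category.assoc _ _ _).symm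
      · exact (congrArg (_ ≫ ·) (conn_comp X _ _).symm).trans (Category.assoc _ _ _).symm
  have hXlim : X.IsWellOrderContinuous := ⟨fun i hi => by
    exact ⟨isColimitOfPreserves (forget C) (F.isColimitOfIsWellOrderContinuous i hi)⟩⟩
  have hmarked {j i : Ordinal.{v}} (hj : 2 ∣ j) (hji : j + 1 ≤ i) ⦃A A' : C⦄ (h : A ⟶ A')
      (hh : H h) (f : A ⟶ X.obj j) :
      (F.obj i).rel h (f ≫ conn X (le_self_add.trans hji)) (s j hj h hh f ≫ conn X hji) := by
    have := (F.map (homOfLE hji)).rel h _ _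
      (((hs j hj).rel_iff h _ _).2 (Or.inr ⟨hh, f, rfl, rfl⟩))
    have e : f ≫ conn X (le_self_add.trans hji) = (f ≫ conn X le_self_add) ≫ conn X hji := by
      rw [Category.assoc, conn_comp]
    exact (congrArg (fun z => (F.obj i).rel h z (s j hj h hh f ≫ conn X hji)) e).mpr this
  exact ⟨{
    X := X
    zeroIso := (forget C).mapIso e₀
    limit_isColimit := hXlim
    limit_orderEpi := fun i hi Z a b hab =>
      hC.le_of_isColimit (X.isColimitOfIsWellOrderContinuous i hi) a b fun j => hab j.1 j.2
    slash := fun i hi A A' h hh f => s i hi h hh f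
    slash_comm := fun i hi A A' h hh f => (hs i hi).comm h hh f
    odd_existsUnique := fun i hi Z p q hpq => (hs i hi).existsUnique p q hpq
    odd_orderEpi := fun i hi Z a b h₁ h₂ => (hs i hi).orderEpi a b h₁ h₂
    even_le := fun i hi j hj hji A A' h hh f g hfg => by
      have := (heven i hi).le h _ _ g hh (hmarked hj (add_le_add_left hji 1) h hh f) hfg
      exact (Category.assoc _ _ _).symm.le.trans this
    even_existsUnique := fun i hi Z d hd => by
      refine (heven i hi).existsUnique d fun A A' h f f' g hh hf hg => ?_
      obtain ⟨j, hj, hji, hh', u, rfl, rfl⟩ := hrel (i + 1) h f f' hf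
      exact (Category.assoc _ _ _).le.trans (hd hj (by simpa using hji) h hh' u g hg)
    even_orderEpi := fun i hi => (heven i hi).orderEpi }⟩

end ChainExistence

/-! ### Reiterman functions and images of the connecting maps -/

section Reiterman

lemma exists_two_dvd_gt (i : Ordinal.{v}) : ∃ s, i < s ∧ 2 ∣ s := by
  by_cases h : 2 ∣ i + 1
  · exact ⟨i + 1, Order.lt_add_one_iff.2 le_rfl, h⟩
  · exact ⟨i + 1 + 1, Order.lt_add_one_iff.2 le_self_add, two_dvd_add_one h⟩

/-- A function from an unbounded set of ordinals to a small type eventually takes only values that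
it takes arbitrarily late. -/
lemma exists_forall_cofinal_fiber {ι : Type v} {J : Set Ordinal.{v}} (a : J → ι) :
    ∃ t : Ordinal.{v}, ∀ j : J, t ≤ j → ∀ k : Ordinal.{v}, ∃ j' : J, k ≤ j' ∧ a j' = a j := by
  have hb (x : ι) : ∃ b : Ordinal.{v}, (∃ k : Ordinal.{v}, ∀ j' : J, k ≤ j' → a j' ≠ x) →
      ∀ j' : J, b ≤ j' → a j' ≠ x := by
    by_cases h : ∃ k : Ordinal.{v}, ∀ j' : J, k ≤ j' → a j' ≠ x
    · obtain ⟨k, hk⟩ := h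
      exact ⟨k, fun _ => hk⟩
    · exact ⟨0, fun h' => (h h').elim⟩
  choose b hb using hb
  refine ⟨⨆ x, b x, fun j hj => ?_⟩
  by_contra! h
  exact hb (a j) h j ((Ordinal.le_iSup b (a j)).trans hj) rfl

variable {C : Type u} [Category.{v} C] [OrderEnriched C] {E M : MorphismProperty C}

/-- By cowellpoweredness, the quotients of `X_i` represented by the connecting maps out of `X_i`
eventually repeat; since they form a decreasing chain, they stabilize. -/
theorem exists_quotientsStabilizeAt (hEM : IsProperFactorizationSystem E M)
    (hE : IsCowellpowered E) (X : Ordinal.{v} ⥤ C) (i : Ordinal.{v}) :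
    ∃ s, QuotientsStabilizeAt E M X i s := by
  have hfac (j : Set.Ici i) := hEM.factorization (conn X j.2)
  choose Z e m he hm hem using hfac
  obtain ⟨ι, Y, q, hq⟩ := hE (X.obj i)
  have hq' (j : Set.Ici i) := hq (e j) (he j)
  choose a s hs using hq'
  obtain ⟨t, ht⟩ := exists_forall_cofinal_fiber a
  have hd (j k : Set.Ici i) (hjk : j ≤ k) : ∃ d : Z j ⟶ Z k, e j ≫ d = e k := by
    obtain ⟨d, ⟨hd, -⟩, -⟩ := hEM.diagonal (e j) (m k) (e k) (m j ≫ conn X hjk) (he j) (hm k)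
      (by rw [hem k, ← Category.assoc, hem j]; exact (conn_comp X j.2 hjk).symm)
    exact ⟨d, hd⟩
  let j₀ : Set.Ici i := ⟨max i t, le_max_left i t⟩
  refine ⟨max i t, Z j₀, e j₀, he j₀, fun j hij hj => ?_⟩
  obtain ⟨k, hjk, hk⟩ := ht j₀ (le_max_right i t) j
  obtain ⟨d, hd₁⟩ := hd j₀ ⟨j, hij⟩ hj
  obtain ⟨d', hd₂⟩ := hd ⟨j, hij⟩ k hjk
  obtain ⟨u, hu⟩ : ∃ u : Z k ⟶ Z j₀, e k ≫ u = e j₀ := by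
    refine ⟨(s k).inv ≫ eqToHom (by rw [hk]) ≫ (s j₀).hom, ?_⟩
    have hqk : q (a k) ≫ eqToHom (by rw [hk]) = q (a j₀) := by
      generalize a k = x at hk
      subst hk
      simp
    rw [← hs k, Category.assoc, Iso.hom_inv_id_assoc, ← Category.assoc, hqk, hs]
  have := hEM.epi _ (he j₀)
  have := hEM.epi _ (he ⟨j, hij⟩)
  have hdu : d ≫ d' ≫ u = 𝟙 _ := by
    rw [← cancel_epi (e j₀), reassoc_of% hd₁, reassoc_of% hd₂, hu, Category.comp_id]
  have hud : (d' ≫ u) ≫ d = 𝟙 _ := by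
    rw [← cancel_epi (e ⟨j, hij⟩), Category.assoc, reassoc_of% hd₂, reassoc_of% hu, hd₁,
      Category.comp_id]
  have : IsIso d := ⟨d' ≫ u, hdu, hud⟩
  have := hEM.respectsIso_right
  exact ⟨d ≫ m ⟨j, hij⟩, MorphismProperty.RespectsIso.precomp M _ _ (hm _),
    by rw [← Category.assoc, hd₁, hem]⟩

/-- Reiterman functions exist, with an arbitrarily large value at `1`. -/
theorem exists_isReitermanFunction (hEM : IsProperFactorizationSystem E M)
    (hE : IsCowellpowered E) (X : Ordinal.{v} ⥤ C) (i₀ : Ordinal.{v}) :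
    ∃ φ, IsReitermanFunction E M X φ ∧ i₀ ≤ φ 1 := by
  have hnext (i : Ordinal.{v}) : ∃ s, i < s ∧ 2 ∣ s ∧ i₀ ≤ s ∧ QuotientsStabilizeAt E M X i s := by
    obtain ⟨t, Q, e, he, ht⟩ := exists_quotientsStabilizeAt hEM hE X i
    obtain ⟨s, hs, hs'⟩ := exists_two_dvd_gt (max i (max i₀ t))
    simp only [max_lt_iff] at hs
    exact ⟨s, hs.1, hs', hs.2.1.le, Q, e, he, fun j hij hj => ht hij (hs.2.2.le.trans hj)⟩
  choose next h₁ h₂ h₃ h₄ using hnext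
  let φ (i : Ordinal.{v}) : Ordinal.{v} :=
    Ordinal.limitRecOn i 0 (fun _ x => next x) fun i _ f => ⨆ x : Set.Iio i, f x.1 x.2
  have hsucc (i : Ordinal.{v}) : φ (i + 1) = next (φ i) := Ordinal.limitRecOn_add_one ..
  refine ⟨φ, ⟨Ordinal.limitRecOn_zero .., fun i => ?_, fun i => ?_, fun i => ?_,
    fun i hi => ?_⟩, ?_⟩
  · rw [hsucc]; exact h₁ _
  · rw [hsucc]; exact h₂ _
  · rw [hsucc]; exact h₄ _
  · have : φ i = ⨆ x : Set.Iio i, φ x := Ordinal.limitRecOn_limit _ _ _ _ hi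
    have : Nonempty (Set.Iio i) := ⟨0, hi.bot_lt⟩
    rw [‹φ i = _›, Set.image_eq_range]
    exact isLUB_ciSup Ordinal.bddAbove_of_small
  · rw [← zero_add (1 : Ordinal.{v}), hsucc]
    exact h₃ _

end Reiterman

namespace IsReitermanFunction

variable {C : Type u} [Category.{v} C] {E M : MorphismProperty C}
variable {X : Ordinal.{v} ⥤ C} {φ : Ordinal.{v} → Ordinal.{v}}

lemma strictMono (hφ : IsReitermanFunction E M X φ) : StrictMono φ := by
  intro i j hij
  induction j using Ordinal.limitRecOn with
  | zero => exact absurd hij (not_lt_zero)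
  | add_one j ih =>
    obtain h | rfl := (Order.lt_add_one_iff.1 hij).lt_or_eq
    · exact (ih h).trans (hφ.lt_succ j)
    · exact hφ.lt_succ i
  | limit j hj _ =>
    exact (hφ.lt_succ i).trans_le ((hφ.limit j hj).1 ⟨i + 1, hj.add_one_lt hij, rfl⟩)

lemma monotone (hφ : IsReitermanFunction E M X φ) : Monotone φ := hφ.strictMono.monotone

lemma exists_lt (hφ : IsReitermanFunction E M X φ) {l : Ordinal.{v}} (hl : Order.IsSuccLimit l)
    {j : Ordinal.{v}} (hj : j < φ l) : ∃ i < l, j < φ i := by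
  obtain ⟨_, ⟨i, hi, rfl⟩, hji⟩ := (lt_isLUB_iff (hφ.limit l hl)).1 hj
  exact ⟨i, hi, hji⟩

lemma isSuccLimit (hφ : IsReitermanFunction E M X φ) {l : Ordinal.{v}}
    (hl : Order.IsSuccLimit l) : Order.IsSuccLimit (φ l) := by
  refine ⟨?_, ?_⟩
  · rw [isMin_iff_eq_bot]
    exact ((zero_le (a := φ 0)).trans_lt (hφ.strictMono hl.bot_lt)).ne'
  · refine Order.isSuccPrelimit_of_succ_lt fun j hj => ?_
    obtain ⟨i, hi, hji⟩ := hφ.exists_lt hl hj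
    exact (Order.succ_le_of_lt hji).trans_lt (hφ.strictMono hi)

end IsReitermanFunction

section LimitStages

variable {C : Type u} [Category.{v} C] (X : Ordinal.{v} ⥤ C) [X.IsWellOrderContinuous]
  {l : Ordinal.{v}}

lemma hom_ext_of_isSuccLimit (hl : Order.IsSuccLimit l) {Q : C} {a b : X.obj l ⟶ Q}
    (h : ∀ (j : Ordinal.{v}) (hj : j < l), conn X hj.le ≫ a = conn X hj.le ≫ b) : a = b :=
  (X.isColimitOfIsWellOrderContinuous l hl).hom_ext fun j => h j.1 j.2

lemma exists_desc (hl : Order.IsSuccLimit l) {Q : C} (u : ∀ j < l, X.obj j ⟶ Q)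
    (hu : ∀ (j k : Ordinal.{v}) (hjk : j ≤ k) (hk : k < l),
      conn X hjk ≫ u k hk = u j (hjk.trans_lt hk)) :
    ∃ d : X.obj l ⟶ Q, ∀ (j : Ordinal.{v}) (hj : j < l), conn X hj.le ≫ d = u j hj := by
  let c : Cocone ((Set.principalSegIio l).monotone.functor ⋙ X) :=
    { pt := Q
      ι :=
        { app := fun j => u j.1 j.2
          naturality := fun j k g =>
            (hu j.1 k.1 (leOfHom g) k.2).trans (Category.comp_id _).symm } }
  exact ⟨(X.isColimitOfIsWellOrderContinuous l hl).desc c, fun j hj =>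
    (X.isColimitOfIsWellOrderContinuous l hl).fac c ⟨j, hj⟩⟩

end LimitStages

section Factorization

variable {C : Type u} [Category.{v} C] [OrderEnriched C] {E M : MorphismProperty C}

lemma IsOrderMono.mono {X Y : C} {m : X ⟶ Y} (hm : IsOrderMono m) : Mono m :=
  ⟨fun f g h => le_antisymm (hm f g h.le) (hm g f h.ge)⟩

/-- The stage `X_{φ l}`, for `l` a limit ordinal, with the `(E, M)`-factorizations `e a ≫ m a` of
the connecting maps out of `X_{φ a}`, `a < l`. The images `N a` form a chain of subobjects with
union `X_{φ l}`, and by the choice of `φ` each `m a` factorizes through `X_{φ (a + 1)}`. -/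
structure ImageChain {X : Ordinal.{v} ⥤ C} {φ : Ordinal.{v} → Ordinal.{v}}
    (hφ : IsReitermanFunction E M X φ) {l : Ordinal.{v}} (hl : Order.IsSuccLimit l) where
  N : Set.Iio l → C
  m : ∀ a, N a ⟶ X.obj (φ l)
  e : ∀ a : Set.Iio l, X.obj (φ a) ⟶ N a
  lift : ∀ a : Set.Iio l, N a ⟶ X.obj (φ (a + 1))
  m_mem : ∀ a, M (m a)
  e_m : ∀ a, e a ≫ m a = conn X (hφ.monotone a.2.le)
  e_lift : ∀ a, e a ≫ lift a = conn X (hφ.monotone le_self_add)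
  lift_conn : ∀ a, lift a ≫ conn X (hφ.monotone (hl.add_one_lt a.2).le) = m a
  exists_le : ∀ a b, a ≤ b → ∃ t : N a ⟶ N b, t ≫ m b = m a
  isUnion : IsUnion M m

theorem exists_imageChain (hEM : IsProperFactorizationSystem E M) {X : Ordinal.{v} ⥤ C}
    [X.IsWellOrderContinuous] {φ : Ordinal.{v} → Ordinal.{v}} (hφ : IsReitermanFunction E M X φ)
    {l : Ordinal.{v}} (hl : Order.IsSuccLimit l) :
    Nonempty (ImageChain hφ hl) := by
  have hmono := hφ.monotone
  choose N e he hN using fun a : Set.Iio l => hφ.stabilizes a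
  choose m hm hem using fun a : Set.Iio l =>
    hN a (hmono a.2.le) (hmono (hl.add_one_lt a.2).le)
  choose lift _ hlift using fun a : Set.Iio l => hN a (hmono le_self_add) le_rfl
  refine ⟨⟨N, m, e, lift, hm, hem, hlift, fun a => ?_, fun a b hab => ?_, ?_⟩⟩
  · have := hEM.epi _ (he a)
    rw [← cancel_epi (e a), reassoc_of% hlift a, conn_comp, hem]
  · obtain ⟨t, ⟨-, ht⟩, -⟩ := hEM.diagonal (e a) (m b) (conn X (hmono hab) ≫ e b) (m a)
      (he a) (hm b)
      (by rw [Category.assoc, hem, conn_comp, hem])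
    exact ⟨t, ht⟩
  · intro Q n hn ht
    have := (hEM.orderMono n hn).mono
    -- Every connecting map into `X_{φ l}` factorizes through `n`.
    have hu (j : Set.Iio (φ l)) : ∃ u : X.obj j ⟶ Q, u ≫ n = conn X (le_of_lt j.2) := by
      obtain ⟨i, hi, hji⟩ := hφ.exists_lt hl j.2
      obtain ⟨t, ht⟩ := ht ⟨i, hi⟩
      exact ⟨conn X hji.le ≫ e ⟨i, hi⟩ ≫ t, by
        rw [Category.assoc, Category.assoc, ht, hem, conn_comp]⟩
    choose u hu using hu
    obtain ⟨d, hd⟩ := exists_desc X (hφ.isSuccLimit hl) (fun j hj => u ⟨j, hj⟩)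
      fun j k hjk hk => by rw [← cancel_mono n, Category.assoc, hu, hu, conn_comp]
    have hdn : d ≫ n = 𝟙 _ := hom_ext_of_isSuccLimit X (hφ.isSuccLimit hl) fun j hj => by
      rw [← Category.assoc, hd j hj, hu, Category.comp_id]
    exact ⟨d, by rw [← cancel_mono n, Category.assoc, hdn, Category.comp_id,
      Category.id_comp], hdn⟩

end Factorization

/-! ### Limit stages as reflections -/

section Lan

variable {C : Type u} [Category.{v} C] [OrderEnriched C]

lemma IsLan.unique {A A' X : C} {h : A ⟶ A'} {f : A ⟶ X} {g g' : A' ⟶ X} (hg : IsLan h f g)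
    (hg' : IsLan h f g') : g = g' :=
  le_antisymm (hg.2 g' hg'.1) (hg'.2 g hg.1)

end Lan

namespace KanReflectionChain

variable {C : Type u} [Category.{v} C] [OrderEnriched C] {H : MorphismProperty C} {X₀ : C}
  (K : KanReflectionChain H X₀)

/-- The morphism `r` out of the stage `X_i` turns all formal extensions `slash h f` that arise
before the stage `i` into left Kan extensions. -/
def PreservesSlash {i : Ordinal.{v}} {P : C} (r : K.X.obj i ⟶ P) : Prop :=
  ∀ ⦃j : Ordinal.{v}⦄ (hj : 2 ∣ j) (hji : j + 1 ≤ i) ⦃A A' : C⦄ (h : A ⟶ A') (hh : H h)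
    (f : A ⟶ K.X.obj j),
    IsLan h (f ≫ conn K.X (le_self_add.trans hji) ≫ r) (K.slash hj h hh f ≫ conn K.X hji ≫ r)

variable {K}

lemma PreservesSlash.conn {i i' : Ordinal.{v}} (hi : i ≤ i') {P : C} {r : K.X.obj i' ⟶ P}
    (hr : K.PreservesSlash r) : K.PreservesSlash (conn K.X hi ≫ r) := by
  intro j hj hji A A' h hh f
  have := hr hj (hji.trans hi) h hh f
  rwa [conn_comp_assoc, conn_comp_assoc]

/-- A morphism that preserves the formal extensions is determined, even as far as the order is
concerned, by its restriction to the initial stage. Nothing is required of the morphism `r'`. -/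
lemma PreservesSlash.le {i : Ordinal.{v}} {P : C} {r r' : K.X.obj i ⟶ P} (hr : K.PreservesSlash r)
    (h₀ : KanInj.conn K.X (zero_le : 0 ≤ i) ≫ r ≤ KanInj.conn K.X (zero_le : 0 ≤ i) ≫ r') :
    r ≤ r' := by
  suffices h : ∀ (k : Ordinal.{v}) (hk : k ≤ i), KanInj.conn K.X hk ≫ r ≤ KanInj.conn K.X hk ≫ r' by
    simpa [conn_refl] using h i le_rfl
  intro k
  induction k using ordinal_parity_induction with
  | zero => exact fun _ => h₀
  | odd k hk ih =>
    intro hki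
    have hkr := ih (le_self_add.trans hki)
    refine K.odd_orderEpi hk _ _ ?_ fun A A' h hh f => ?_
    · simpa only [conn_comp_assoc] using hkr
    · refine (hr hk hki h hh f).2 _ ?_
      rw [reassoc_of% K.slash_comm hk h hh f, conn_comp_assoc]
      exact comp_le_comp_left f hkr
  | even k hk ih =>
    intro hki
    refine K.even_orderEpi hk _ _ ?_
    simpa only [conn_comp_assoc] using ih (le_self_add.trans hki)
  | limit k hk ih =>
    intro hki
    refine K.limit_orderEpi k hk _ _ fun j hj => ?_
    simpa only [conn_comp_assoc] using ih j hj (hj.le.trans hki)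

lemma PreservesSlash.eq {i : Ordinal.{v}} {P : C} {r r' : K.X.obj i ⟶ P} (hr : K.PreservesSlash r)
    (hr' : K.PreservesSlash r')
    (h₀ : KanInj.conn K.X (zero_le : 0 ≤ i) ≫ r = KanInj.conn K.X (zero_le : 0 ≤ i) ≫ r') :
    r = r' :=
  le_antisymm (hr.le h₀.le) (hr'.le h₀.ge)

variable (K)

/-- A morphism from the initial stage into a left Kan-injective object extends to all stages. -/
lemma exists_preservesSlash {P : C} (hP : (LInj H).obj P) (p : K.X.obj 0 ⟶ P) (i : Ordinal.{v}) :
    ∃ r : K.X.obj i ⟶ P, K.PreservesSlash r ∧ KanInj.conn K.X (zero_le : 0 ≤ i) ≫ r = p := by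
  induction i using ordinal_parity_induction with
  | zero =>
    refine ⟨p, fun j _ hj => absurd hj ?_, by rw [conn_refl, Category.id_comp]⟩
    exact not_le.2 (Order.lt_add_one_iff.2 zero_le)
  | odd i hi ih =>
    obtain ⟨r, hr, hr₀⟩ := ih
    choose q hq using fun (A A' : C) (h : A ⟶ A') (hh : H h) (f : A ⟶ K.X.obj i) => hP h hh (f ≫ r)
    obtain ⟨r', ⟨h₁, h₂⟩, -⟩ := K.odd_existsUnique hi r (fun A A' h hh f => q A A' h hh f)
      fun A A' h hh f => (hq A A' h hh f).2
    refine ⟨r', fun j hj hji A A' h hh f => ?_, by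
      rw [← hr₀, ← h₁, conn_comp_assoc]⟩
    obtain hji' | rfl := (show j ≤ i by simpa using hji).lt_or_eq
    · have := hr hj (Order.add_one_le_of_lt hji') h hh f
      rwa [← h₁, conn_comp_assoc, conn_comp_assoc] at this
    · rw [h₁, conn_refl, Category.id_comp, h₂]
      exact (hq A A' h hh f).1
  | even i hi ih =>
    obtain ⟨r, hr, hr₀⟩ := ih
    obtain ⟨r', h₁, -⟩ := K.even_existsUnique hi r fun j hj hji A A' h hh f g hfg =>
      (hr hj (add_le_add_left hji 1) h hh f).2 _ (by
        simpa only [Category.assoc] using comp_le_comp_right hfg r)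
    have h₁ : KanInj.conn K.X le_self_add ≫ r' = r := h₁
    refine ⟨r', fun j hj hji A A' h hh f => ?_, by rw [← hr₀, ← h₁, conn_comp_assoc]⟩
    have hji' : j + 1 ≤ i + 1 := by
      refine Order.add_one_le_of_lt ((show j ≤ i + 1 by simpa using hji).lt_of_ne ?_)
      rintro rfl
      exact not_two_dvd_add_one hi hj
    have := hr hj hji' h hh f
    rwa [← h₁, conn_comp_assoc, conn_comp_assoc] at this
  | limit i hi ih =>
    choose r hr hr₀ using ih
    have := K.limit_isColimit
    obtain ⟨d, hd⟩ := exists_desc K.X hi r fun j k hjk hk =>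
      PreservesSlash.eq ((hr k hk).conn hjk) (hr j _) (by rw [conn_comp_assoc, hr₀, hr₀])
    refine ⟨d, fun j hj hji A A' h hh f => ?_, by rw [hd 0 hi.bot_lt, ← hr₀ 0 hi.bot_lt, conn_refl,
      Category.id_comp]⟩
    have hji' : j + 1 < i := hi.add_one_lt ((Order.lt_add_one_iff.2 le_rfl).trans_le hji)
    have := hr _ hji' hj le_rfl h hh f
    rwa [← hd, conn_comp_assoc, conn_comp_assoc] at this

variable {E M : MorphismProperty C} {φ : Ordinal.{v} → Ordinal.{v}} 
  {hφ : IsReitermanFunction E M K.X φ} {l : Ordinal.{v}} {hl : Order.IsSuccLimit l}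

/-- Domains and codomains of members of `H` are small relative to the given stage: morphisms from
them to this stage factorize through its chain of images. Nothing is required of those `h` in `H`
whose domain admits no morphism to the stage, since they impose no condition on it. -/
def IsSmallAt (I : ImageChain hφ hl) : Prop :=
  ∀ ⦃A A' : C⦄ (h : A ⟶ A'), H h → (A ⟶ K.X.obj (φ l)) →
    (∀ p : A ⟶ K.X.obj (φ l), ∃ a q, q ≫ I.m a = p) ∧
      ∀ p : A' ⟶ K.X.obj (φ l), ∃ a q, q ≫ I.m a = p

variable {K}

/-- In a stage `X_{φ l}` relative to which `H` is small, the formal extensions are left Kan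
extensions. A competitor `g` factorizes through some `m a`; as `m a` is an order-monomorphism, the
inequality that `g` satisfies holds already in `X_{φ (a + 1)}`, where the next two steps of the
chain apply to it. -/
lemma isLan_slash (hEM : IsProperFactorizationSystem E M)
    (I : ImageChain hφ hl) (hI : K.IsSmallAt I) :
    K.PreservesSlash (𝟙 (K.X.obj (φ l))) := by
  intro i hi hil A A' h hh f
  simp only [Category.comp_id]
  refine ⟨by rw [reassoc_of% K.slash_comm hi h hh f, conn_comp], fun g hg => ?_⟩
  obtain ⟨a, q, rfl⟩ := (hI h hh (f ≫ conn K.X (le_self_add.trans hil))).2 g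
  obtain ⟨b, hab, hib⟩ : ∃ b : Set.Iio l, a ≤ b ∧ i ≤ φ b := by
    obtain ⟨b, hb, hib⟩ := hφ.exists_lt hl ((Order.lt_add_one_iff.2 le_rfl).trans_le hil)
    exact ⟨⟨max a.1 b, max_lt a.2 hb⟩, le_max_left a.1 b,
      hib.le.trans (hφ.monotone (le_max_right a.1 b))⟩
  obtain ⟨t, ht⟩ := I.exists_le a b hab
  have hk : φ (b + 1) + 1 + 1 ≤ φ l :=
    ((hφ.isSuccLimit hl).add_one_lt ((hφ.isSuccLimit hl).add_one_lt
      (hφ.strictMono (hl.add_one_lt b.2)))).le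
  have hik : i ≤ φ (b + 1) := hib.trans (hφ.monotone le_self_add)
  have h₁ : f ≫ conn K.X hib ≫ I.e b ≤ h ≫ q ≫ t := by
    refine hEM.orderMono _ (I.m_mem b) _ _ ?_
    simpa only [Category.assoc, I.e_m, conn_comp, ht] using hg
  have h₂ := comp_le_comp_right h₁ (I.lift b ≫ conn K.X (le_self_add : φ (b + 1) ≤ φ (b + 1) + 1))
  simp only [Category.assoc, reassoc_of% I.e_lift b, conn_comp] at h₂
  have h₃ := K.even_le (hφ.even_succ b) hi hik h hh f (q ≫ t ≫ I.lift b ≫ conn K.X le_self_add) (by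
    simpa only [Category.assoc] using h₂)
  have h₄ := comp_le_comp_right h₃ (conn K.X hk)
  simpa only [Category.assoc, conn_comp, I.lift_conn, ht] using h₄

/-- The stage `X_{φ l}` is a reflection if `H` is small relative to it. The second part is the
two-dimensional aspect of its universal property: it compares a morphism `q` of the subcategory with
an arbitrary morphism `p`. -/
theorem isReflection (hEM : IsProperFactorizationSystem E M)
    (I : ImageChain hφ hl) (hI : K.IsSmallAt I) :
    (LInj H).IsReflection (K.zeroIso.hom ≫ conn K.X (zero_le : 0 ≤ φ l)) ∧
      ∀ ⦃P : C⦄ (q p : K.X.obj (φ l) ⟶ P), (LInj H).hom q →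
        (K.zeroIso.hom ≫ conn K.X (zero_le : 0 ≤ φ l)) ≫ q ≤
          (K.zeroIso.hom ≫ conn K.X (zero_le : 0 ≤ φ l)) ≫ p → q ≤ p := by
  have hlan := isLan_slash hEM I hI
  have hlan' {i : Ordinal.{v}} (hi : 2 ∣ i) (hil : i + 1 ≤ φ l) ⦃A A' : C⦄ (h : A ⟶ A') (hh : H h)
      (f : A ⟶ K.X.obj i) :
      IsLan h (f ≫ conn K.X (le_self_add.trans hil)) (K.slash hi h hh f ≫ conn K.X hil) := by
    simpa only [Category.comp_id] using hlan hi hil h hh f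
  -- Every morphism to the stage from the domain of a member of `H` comes from an even stage before.
  have hfac ⦃A A' : C⦄ (h : A ⟶ A') (hh : H h) (f : A ⟶ K.X.obj (φ l)) :
      ∃ (i : Ordinal.{v}) (_ : 2 ∣ i) (hil : i + 1 ≤ φ l) (f' : A ⟶ K.X.obj i),
        f' ≫ conn K.X (le_self_add.trans hil) = f := by
    obtain ⟨a, q, rfl⟩ := (hI h hh f).1 f
    exact ⟨φ (a + 1), hφ.even_succ a,
      ((hφ.isSuccLimit hl).add_one_lt (hφ.strictMono (hl.add_one_lt a.2))).le, q ≫ I.lift a, by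
        rw [Category.assoc, I.lift_conn]⟩
  have hobj : (LInj H).obj (K.X.obj (φ l)) := by
    intro A A' h hh f
    obtain ⟨i, hi, hil, f, rfl⟩ := hfac h hh f
    refine ⟨_, hlan' hi hil h hh f, ?_⟩
    rw [reassoc_of% K.slash_comm hi h hh f, conn_comp]
  -- The morphisms of the subcategory out of the stage are those that preserve formal extensions.
  have hhom {P : C} (q : K.X.obj (φ l) ⟶ P) (hq : (LInj H).hom q) : K.PreservesSlash q := by
    intro i hi hil A A' h hh f
    simpa only [Category.assoc] using (hq.2.2 h hh).2.2 _ _ (hlan' hi hil h hh f)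
  have hhom' {P : C} (hP : (LInj H).obj P) (q : K.X.obj (φ l) ⟶ P) (hq : K.PreservesSlash q) :
      (LInj H).hom q := by
    refine ⟨hobj, hP, fun A A' h hh => ⟨hobj h hh, hP h hh, fun f g hg => ?_⟩⟩
    obtain ⟨i, hi, hil, f, rfl⟩ := hfac h hh f
    rw [hg.unique (hlan' hi hil h hh f)]
    simpa only [Category.assoc] using hq hi hil h hh f
  refine ⟨⟨hobj, fun P hP p => ?_⟩, fun P q p hq hqp => ?_⟩
  · obtain ⟨r, hr, hr₀⟩ := K.exists_preservesSlash hP (K.zeroIso.inv ≫ p) (φ l)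
    refine ⟨r, ⟨hhom' hP r hr, by simp [hr₀]⟩, fun q hq => ?_⟩
    refine (hhom q hq.1).eq hr ?_
    rw [hr₀, ← hq.2, Category.assoc, Iso.inv_hom_id_assoc]
  · refine (hhom q hq).le ?_
    simpa using comp_le_comp_left K.zeroIso.inv hqp

end KanReflectionChain

/-! ### The choice of a stage that is a reflection -/

namespace KanReflectionChain

variable {C : Type u} [Category.{v} C] [OrderEnriched C] {E M : MorphismProperty C}
  {H : MorphismProperty C} {X₀ : C} (K : KanReflectionChain H X₀)

lemma isSmallAt_of_hasRank {κ : Cardinal.{v}}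
    (hκ : ∀ ⦃A A' : C⦄ (h : A ⟶ A'), H h → HasRank M κ A ∧ HasRank M κ A')
    {φ : Ordinal.{v} → Ordinal.{v}} {hφ : IsReitermanFunction E M K.X φ}
    {hl : Order.IsSuccLimit κ.ord} (I : ImageChain hφ hl) : K.IsSmallAt I :=
  fun _ _ h hh _ => ⟨(hκ h hh).1.2 I.N I.m I.m_mem I.exists_le I.isUnion,
    (hκ h hh).2.2 I.N I.m I.m_mem I.exists_le I.isUnion⟩

/-- There is a regular cardinal `κ` such that `H` is small relative to the stage `X_{φ κ}` for
suitable `φ`. Having rank `κ` does not imply having rank `κ'` for `κ' ≥ κ`, because ranks refer to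
chains of a fixed length; so the members of `H` need not have a common rank. Instead, `κ` is taken
to be the rank of the coproduct of the domains and codomains of those members of `H` whose domain
admits a morphism to some stage, and `φ` starts after such morphisms have appeared: then a morphism
from one summand to the stage extends to the whole coproduct, and so factorizes. -/
theorem exists_isSmallAt (hC : IsLocallyRanked E M) [MorphismProperty.IsSmall.{v} H] :
    ∃ (κ : Cardinal.{v}) (φ : Ordinal.{v} → Ordinal.{v}) (_ : κ.IsRegular)
      (hφ : IsReitermanFunction E M K.X φ) (hl : Order.IsSuccLimit κ.ord)
      (I : ImageChain hφ hl), K.IsSmallAt I := by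
  let T := { a : H.toSet // ∃ i : Ordinal.{v}, 2 ∣ i ∧ Nonempty (a.1.left ⟶ K.X.obj i) }
  have hT (a : T) : ∃ i : Ordinal.{v}, 2 ∣ i ∧ Nonempty (a.1.1.left ⟶ K.X.obj i) := a.2
  choose st hst hne using hT
  let B : T ⊕ T → C := Sum.elim (fun a => a.1.1.left) (fun a => a.1.1.right)
  have := hC.hasWeightedColimits.hasColimitsOfShape (Discrete (T ⊕ T))
  obtain ⟨κ, hκ⟩ := hC.rank (∐ B)
  have hl : Order.IsSuccLimit κ.ord := Cardinal.isSuccLimit_ord hκ.1.aleph0_le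
  obtain ⟨φ, hφ, hφ₁⟩ := exists_isReitermanFunction hC.proper hC.cowellpowered K.X
    (⨆ a : T, (st a + 1))
  have := K.limit_isColimit
  obtain ⟨I⟩ := exists_imageChain hC.proper hφ hl
  have hstage (a : T) : st a + 1 ≤ φ κ.ord :=
    ((Ordinal.le_iSup (fun a : T => st a + 1) a).trans hφ₁).trans
      (hφ.monotone (Order.one_le_iff_pos.2 hl.bot_lt))
  have hB : ∀ b, Nonempty (B b ⟶ K.X.obj (φ κ.ord)) := by
    rintro (a | a)
    · exact ⟨(hne a).some ≫ conn K.X (le_self_add.trans (hstage a))⟩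
    · exact ⟨K.slash (hst a) a.1.1.hom a.1.2 (hne a).some ≫ conn K.X (hstage a)⟩
  have key (b : T ⊕ T) (p : B b ⟶ K.X.obj (φ κ.ord)) : ∃ a q, q ≫ I.m a = p := by
    classical
    obtain ⟨a, q, hq⟩ := hκ.2 I.N I.m I.m_mem I.exists_le I.isUnion
      (Sigma.desc (Function.update (fun b => (hB b).some) b p))
    exact ⟨a, Sigma.ι B b ≫ q, by rw [Category.assoc, hq]; simp⟩
  refine ⟨κ, φ, hκ.1, hφ, hl, I, fun A A' h hh f => ?_⟩
  let a : T := ⟨⟨Arrow.mk h, hh⟩, φ κ.ord, two_dvd_of_isSuccLimit (hφ.isSuccLimit hl), ⟨f⟩⟩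
  exact ⟨key (Sum.inl a), key (Sum.inr a)⟩

end KanReflectionChain

/-! ### The Kock-Zöberlein monad and its algebras -/

lemma algebra_eqToHom_f{C : Type u} [Category.{v} C] {T : Monad C} {A A' : T.Algebra}
    (h : A = A') : (eqToHom h).f = eqToHom (congrArg Monad.Algebra.A h) := by
  subst h
  rfl

section KZ

variable {C : Type u} [Category.{v} C] [OrderEnriched C] {H : MorphismProperty C}
  {F : C ⥤ (LInj H).Obj} (adj : F ⊣ (LInj H).incl)

/-- The reflection of `X`, i.e. the unit of the adjunction. -/
def reflMap (X : C) : X ⟶ (F.obj X).val := adj.unit.app X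

/-- The two-dimensional part of the universal property of the reflections. -/
def IsOrderReflection : Prop :=
  ∀ ⦃X P : C⦄ (q p : (F.obj X).val ⟶ P), (LInj H).hom q →
    reflMap adj X ≫ q ≤ reflMap adj X ≫ p → q ≤ p

variable {adj}

lemma unit_comp_map (adj : F ⊣ (LInj H).incl) {X Y : C} (f : X ⟶ Y) :
    reflMap adj X ≫ (F.map f).val = f ≫ reflMap adj Y :=
  (adj.unit.naturality f).symm

lemma isKZMonad_toMonad (hadj : IsOrderReflection adj) : IsKZMonad adj.toMonad := by
  refine ⟨fun X Y f g hfg => ?_, fun X => ?_⟩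
  · refine hadj (F.map f).val (F.map g).val (F.map f).property ?_
    rw [unit_comp_map, unit_comp_map]
    exact comp_le_comp_right hfg _
  · exact hadj (F.map (reflMap adj X)).val _ (F.map (reflMap adj X)).property
      (unit_comp_map adj _).le

variable (A : adj.toMonad.Algebra)

/-- The structure morphism of an algebra, with its domain written as a reflection. -/
def structureMap : (F.obj A.A).val ⟶ A.A := A.a

lemma unit_structureMap : reflMap adj A.A ≫ structureMap A = 𝟙 A.A := A.unit

/-- Together with `unit_structureMap`: the structure morphism of an algebra is left adjoint to the
unit. -/
lemma le_structureMap_unit (hadj : IsOrderReflection adj) :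
    𝟙 _ ≤ structureMap A ≫ reflMap adj A.A := by
  refine hadj _ _ ((LInj H).id (F.obj A.A).property) ?_
  rw [reassoc_of% unit_structureMap A]
  exact (Category.comp_id _).le

/-- Being a left adjoint, the structure morphism of an algebra preserves left Kan extensions. -/
lemma IsLan.comp_structureMap (hadj : IsOrderReflection adj) {B B' : C} {h : B ⟶ B'}
    {f : B ⟶ (F.obj A.A).val} {g : B' ⟶ (F.obj A.A).val} (hg : IsLan h f g) :
    IsLan h (f ≫ structureMap A) (g ≫ structureMap A) := by
  refine ⟨by simpa only [Category.assoc] using comp_le_comp_right hg.1 (structureMap A),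
    fun g' hg' => ?_⟩
  have h₁ : f ≤ h ≫ g' ≫ reflMap adj A.A := by
    have h₂ := comp_le_comp_left f (le_structureMap_unit A hadj)
    have h₃ := comp_le_comp_right hg' (reflMap adj A.A)
    simp only [Category.assoc, Category.comp_id] at h₂ h₃
    exact h₂.trans h₃
  have := comp_le_comp_right (hg.2 _ h₁) (structureMap A)
  rwa [Category.assoc, unit_structureMap, Category.comp_id] at this

/-- Left Kan extensions in an algebra are computed in its reflection and then projected by the
structure morphism. -/
lemma exists_isLan_algebra (hadj : IsOrderReflection adj) {B B' : C} (h : B ⟶ B') (hh : H h)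
    (f : B ⟶ A.A) : ∃ g : B' ⟶ (F.obj A.A).val, IsLan h (f ≫ reflMap adj A.A) g ∧
      IsLan h f (g ≫ structureMap A) ∧ h ≫ g ≫ structureMap A = f := by
  obtain ⟨g, hg, hg'⟩ := (F.obj A.A).property h hh (f ≫ reflMap adj A.A)
  have h₁ := hg.comp_structureMap A hadj
  rw [Category.assoc, unit_structureMap, Category.comp_id] at h₁
  refine ⟨g, hg, h₁, ?_⟩
  rw [reassoc_of% hg', unit_structureMap, Category.comp_id]

lemma obj_of_algebra (hadj : IsOrderReflection adj) : (LInj H).obj A.A := fun B B' h hh f => by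
  obtain ⟨g, -, hg⟩ := exists_isLan_algebra A hadj h hh f
  exact ⟨_, hg⟩

lemma hom_structureMap (hadj : IsOrderReflection adj) : (LInj H).hom (structureMap A) :=
  ⟨(F.obj A.A).property, obj_of_algebra A hadj, fun _ _ h hh =>
    ⟨(F.obj A.A).property h hh, obj_of_algebra A hadj h hh,
      fun _ _ hg => hg.comp_structureMap A hadj⟩⟩

lemma hom_of_algebraHom (hadj : IsOrderReflection adj) {A A' : adj.toMonad.Algebra} (p : A ⟶ A') :
    (LInj H).hom p.f := by
  refine ⟨obj_of_algebra A hadj, obj_of_algebra A' hadj, fun B B' h hh =>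
    ⟨obj_of_algebra A hadj h hh, obj_of_algebra A' hadj h hh, fun f g hg => ?_⟩⟩
  obtain ⟨k, hk, hk', -⟩ := exists_isLan_algebra A hadj h hh f
  have hp : (F.map p.f).val ≫ structureMap A' = structureMap A ≫ p.f := p.h
  have h₁ := ((F.map p.f).property.2.2 h hh).2.2 _ _ hk
  have h₂ := h₁.comp_structureMap A' hadj
  rw [hg.unique hk']
  simpa only [Category.assoc, hp, reassoc_of% unit_structureMap A] using h₂

/-- The structure morphism of an algebra belongs to the subcategory and retracts the unit, so it
is the counit of the adjunction. -/
lemma comparison_obj_of_algebra (hadj : IsOrderReflection adj) :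
    (Monad.comparison adj).obj ⟨A.A, obj_of_algebra A hadj⟩ = A := by
  have : adj.counit.app ⟨A.A, obj_of_algebra A hadj⟩ =
      ⟨structureMap A, hom_structureMap A hadj⟩ := by
    apply (adj.homEquiv _ _).injective
    rw [adj.homEquiv_unit, adj.homEquiv_unit]
    exact (adj.right_triangle_components _).trans (unit_structureMap A).symm
  have h₂ : (LInj H).incl.map (adj.counit.app ⟨A.A, obj_of_algebra A hadj⟩) = A.a :=
    congrArg Subcat.Hom.val this
  obtain ⟨X, a, _, _⟩ := A
  exact (Monad.Algebra.mk.injEq ..).mpr ⟨rfl, heq_of_eq h₂⟩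

/-- The comparison functor is an isomorphism: algebras are objects of the subcategory in a unique
way, and their homomorphisms are its morphisms. -/
theorem isKZReflective (hadj : IsOrderReflection adj) : (LInj H).IsKZReflective := by
  refine ⟨F, adj, isKZMonad_toMonad hadj,
    { functor := Monad.comparison adj
      inverse :=
        { obj := fun A => ⟨A.A, obj_of_algebra A hadj⟩
          map := fun p => ⟨p.f, hom_of_algebraHom hadj p⟩
          map_id := fun _ => rfl
          map_comp := fun _ _ => rfl }
      unit_eq := rfl
      counit_eq := ?_ }, rfl⟩
  refine CategoryTheory.Functor.ext (fun A => comparison_obj_of_algebra A hadj) fun A A' p => ?_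
  apply Monad.Algebra.Hom.ext
  simp only [Functor.comp_map, Functor.id_map, Monad.Algebra.comp_f, algebra_eqToHom_f]
  exact ((Category.id_comp _).trans (Category.comp_id _)).symm

lemma Subcat.IsKZReflective.isKZMonadic {S : Subcat C} (hS : S.IsKZReflective) :
    S.IsKZMonadic := by
  obtain ⟨F, adj, hT, e, he⟩ := hS
  exact ⟨adj.toMonad, hT, e, by rw [he]; rfl⟩

end KZ

section Reflection

variable {C : Type u} [Category.{v} C] [OrderEnriched C] {H : MorphismProperty C}

/-- If every object has a reflection with the two-dimensional universal property, then the
subcategory is reflective, and KZ-monadic for the induced monad. -/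
theorem isKZReflective_of_isReflection (R : C → C) (r : ∀ X, X ⟶ R X)
    (hr : ∀ X, (LInj H).IsReflection (r X))
    (hr' : ∀ (X : C) ⦃P : C⦄ (q p : R X ⟶ P), (LInj H).hom q → r X ≫ q ≤ r X ≫ p → q ≤ p) :
    (LInj H).IsKZReflective := by
  choose ext hext huniq using fun (X : C) (P : (LInj H).Obj) (p : X ⟶ P.val) =>
    (hr X).2 P.property p
  let e (X : C) (P : (LInj H).Obj) : ((⟨R X, (hr X).1⟩ : (LInj H).Obj) ⟶ P) ≃
      (X ⟶ (LInj H).incl.obj P) :=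
    { toFun := fun q => r X ≫ q.val
      invFun := fun p => ⟨ext X P p, (hext X P p).1⟩
      left_inv := fun q => Subcat.Hom.ext (huniq X P _ q.val ⟨q.property, rfl⟩).symm
      right_inv := fun p => (hext X P p).2 }
  let adj := Adjunction.adjunctionOfEquivLeft e fun X P P' q p => (Category.assoc _ _ _).symm
  refine isKZReflective (adj := adj) fun X P q p hq hqp => hr' X q p hq ?_
  have : reflMap adj X = r X :=
    (Adjunction.mkOfHomEquiv_unit_app _ _).trans (Category.comp_id _)
  rwa [this] at hqp

end Reflection

end KanInj

theorem mainTheorem2 {C : Type u} [Category.{v} C] [OrderEnriched C]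
    (E M : MorphismProperty C) (hC : IsLocallyRanked E M)
    (H : MorphismProperty C) [MorphismProperty.IsSmall.{v} H] :
    (LInj H).IsKZMonadic ∧ (LInj H).IsKZReflective ∧
    ∀ X₀ : C, Nonempty (KanReflectionChain H X₀) ∧
      ∀ K : KanReflectionChain H X₀,
        (∃ (κ : Cardinal.{v}) (φ : Ordinal.{v} → Ordinal.{v}), κ.IsRegular ∧
          IsReitermanFunction E M K.X φ ∧
          (LInj H).IsReflection (K.zeroIso.hom ≫ conn K.X (zero_le : 0 ≤ φ κ.ord))) ∧
        ∀ κ : Cardinal.{v},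
          (∀ ⦃A A' : C⦄ (h : A ⟶ A'), H h → HasRank M κ A ∧ HasRank M κ A') → κ.IsRegular →
          (∃ φ : Ordinal.{v} → Ordinal.{v}, IsReitermanFunction E M K.X φ) ∧
          ∀ φ : Ordinal.{v} → Ordinal.{v}, IsReitermanFunction E M K.X φ →
            (LInj H).IsReflection (K.zeroIso.hom ≫ conn K.X (zero_le : 0 ≤ φ κ.ord)) := by
  have hchain := exists_kanReflectionChain hC.hasWeightedColimits H
  have hKZ : (LInj H).IsKZReflective := by
    have hrefl (X : C) : ∃ (R : C) (r : X ⟶ R), (LInj H).IsReflection r ∧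
        ∀ ⦃P : C⦄ (q p : R ⟶ P), (LInj H).hom q → r ≫ q ≤ r ≫ p → q ≤ p := by
      obtain ⟨K⟩ := hchain X
      obtain ⟨κ, φ, _, hφ, hl, I, hI⟩ := K.exists_isSmallAt hC
      exact ⟨_, _, KanReflectionChain.isReflection hC.proper I hI⟩
    choose R r hr hr' using hrefl
    exact isKZReflective_of_isReflection R r hr hr'
  refine ⟨hKZ.isKZMonadic, hKZ, fun X₀ => ⟨hchain X₀, fun K => ⟨?_, fun κ hκ hreg => ⟨?_, ?_⟩⟩⟩⟩
  · obtain ⟨κ, φ, hκ, hφ, hl, I, hI⟩ := K.exists_isSmallAt hC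
    exact ⟨κ, φ, hκ, hφ, (KanReflectionChain.isReflection hC.proper I hI).1⟩
  · obtain ⟨φ, hφ, -⟩ := exists_isReitermanFunction hC.proper hC.cowellpowered K.X 0
    exact ⟨φ, hφ⟩
  · intro φ hφ
    have := K.limit_isColimit
    obtain ⟨I⟩ := exists_imageChain hC.proper hφ (Cardinal.isSuccLimit_ord hreg.aleph0_le)
    exact (KanReflectionChain.isReflection hC.proper I (K.isSmallAt_of_hasRank hκ I)).1
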